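/- Let $T$ be a complete first-order theory in a language $L$, let $|T|=|L|+\aleph_0$, and let $\mathcal C$ be a monster model of $T$: for some cardinal $\kappa>|T|^+$ it is $\kappa$-saturated and strongly $\kappa$-homogeneous; sets of size $<\kappa$ are called small. All tuples, parameters and formulas are taken in $\mathcal C^{eq}$ (tuples are finite tuples of imaginaries). Definitions. A formula $\delta(x,a)$ *strongly divides* over $A$ if $\mathrm{tp}(a/A)$ is non-algebraic and $\{\delta(x,a')\}_{a'\models \mathrm{tp}(a/A)}$ is $k$-inconsistent for some $k\in\mathbb N$. It *þ-divides* over $A$ if it strongly divides over $Ac$ for some finite tuple $c$. A formula *þ-forks* over $A$ if it implies a finite disjunction of formulas that þ-divide over $A$, and a complete type þ-forks over $A$ if it contains a formula that þ-forks over $A$. A complete type $p$ over a small set is *rosy* if every extension $q$ of $p$ to a complete type over a small set $B$ satisfies local character: there is $B_0\subseteq B$ with $|B_0|\le |T|$ such that $q$ does not þ-fork over $B_0$. $T$ is *finitely coordinatized* by a set $\mathcal P$ of complete types if $\mathcal P$ is closed under automorphisms of $\mathcal C$ and for every tuple $a$ there are $n\in\omega$ and tuples $a_0=\emptyset,a_1,\dots,a_n=a$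 with $\mathrm{tp}(a_i/a_{i-1})\in\mathcal P$ for $1\le i\le n$. For a formula $\phi(x)$ with parameters, a finite set $\Delta$ of formulas in the variables $x;y$, a finite set $\Pi$ of formulas in the variables $y;z$, and $k\in\mathbb N$, the rank þ$(\phi,\Delta,\Pi,k)$ is defined by: it is $\ge 0$ if $\phi$ is consistent; for a limit ordinal $\lambda$, it is $\ge\lambda$ if it is $\ge\alpha$ for all $\alpha<\lambda$; it is $\ge\alpha+1$ if there are $\delta\in\Delta$, $\pi\in\Pi$ and parameters $c$ such that þ$(\phi\wedge\delta(x,a),\Delta,\Pi,k)\ge\alpha$ for infinitely many $a\models\pi(y,c)$, and $\{\delta(x,a)\}_{a\models\pi(y,c)}$ is $k$-inconsistent. $T$ is *rosy* if every such rank is defined, that is, for all $\phi,\Delta,\Pi,k$ as above there is an ordinal $\alpha$ such that þ$(\phi,\Delta,\Pi,k)\ge\alpha$ fails. Theorem. If $T$ is finitely coordinatized by a set $\mathcal P$ all of whose members are rosy types, then $T$ is rosy. -/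

import Mathlib

open FirstOrder FirstOrder.Language Cardinal

universe u v w

namespace Thorn

/-! ### The monster model -/

/-- The cardinal `|T|` of a theory in the language `L`: the number of symbols plus `ℵ₀`. -/
noncomputable def theoryCard (L : FirstOrder.Language.{u, v}) : Cardinal.{max u v} :=
  max ℵ₀ L.card

/-- `M` is `κ`-saturated: every finitely satisfiable set of formulas in finitely many variables
over fewer than `κ` parameters is realized in `M`. -/
def IsSaturated (L : FirstOrder.Language.{u, v}) (κ : Cardinal.{w}) (M : Type w)
    [L.Structure M] : Prop :=
  ∀ (A : Set M), #A < κ → ∀ (n : ℕ) (p : Set (L[[A]].Formula (Fin n))),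
    (∀ s : Finset (L[[A]].Formula (Fin n)), ↑s ⊆ p →
      ∃ x : Fin n → M, ∀ φ ∈ s, φ.Realize x) →
    ∃ x : Fin n → M, ∀ φ ∈ p, φ.Realize x

/-- `M` is strongly `κ`-homogeneous: every partial elementary map with domain of size less than
`κ` extends to an automorphism. -/
def IsStronglyHomogeneous (L : FirstOrder.Language.{u, v}) (κ : Cardinal.{w}) (M : Type w)
    [L.Structure M] : Prop :=
  ∀ (A : Set M), #A < κ → ∀ f : A → M,
    (∀ (n : ℕ) (φ : L.Formula (Fin n)) (x : Fin n → A),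
      φ.Realize (fun i => f (x i)) ↔ φ.Realize (fun i => (x i : M))) →
    ∃ σ : M ≃[L] M, ∀ a : A, σ a = f a

/-- `M` is a monster model, where "small" means "of size less than `κ`": it is `κ`-saturated and
strongly `κ`-homogeneous, and `κ` is larger than `|T|⁺`. -/
structure IsMonster (L : FirstOrder.Language.{u, v}) (κ : Cardinal.{w}) (M : Type w)
    [L.Structure M] : Prop where
  large : Order.succ (Cardinal.lift.{w} (theoryCard L)) < Cardinal.lift.{max u v} κ
  saturated : IsSaturated L κ M
  homogeneous : IsStronglyHomogeneous L κ M

/-! ### Imaginaries -/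

/-- A sort of `M^eq`: an equivalence relation on `M ^ arity` that is definable without
parameters. -/
structure ImSort (L : FirstOrder.Language.{u, v}) (M : Type w) [L.Structure M] where
  arity : ℕ
  rel : L.Formula (Fin arity ⊕ Fin arity)
  equiv : Equivalence fun a b : Fin arity → M => rel.Realize (Sum.elim a b)

variable {L : FirstOrder.Language.{u, v}} {M : Type w} [L.Structure M]

/-- The definable equivalence relation of a sort. -/
def ImSort.setoid (S : ImSort L M) : Setoid (Fin S.arity → M) :=
  ⟨fun a b => S.rel.Realize (Sum.elim a b), S.equiv⟩

variable (L M) in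
/-- The elements of `M^eq`: classes of tuples modulo definable equivalence relations. The elements
of `M` are those of the sort given by equality on `M ^ 1`. -/
def Imag : Type (max u v w) :=
  Σ S : ImSort L M, Quotient S.setoid

/-- The imaginary represented by a real tuple. -/
def ImSort.cls (S : ImSort L M) (a : Fin S.arity → M) : Imag L M :=
  ⟨S, Quotient.mk S.setoid a⟩

variable (L M) in
/-- A formula of `M^eq` without parameters, in the free variables `ι`, each of a given sort. It is
presented by a formula of `L` about representatives: up to equivalence, the formulas of `M^eq` in
free variables of sorts `S i` are "there are representatives of the variables that satisfy `θ`",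
where `θ` is a formula of `L`. -/
structure ImFormula (ι : Type) where
  sort : ι → ImSort L M
  formula : L.Formula (Σ i, Fin (sort i).arity)

/-- Truth of a formula at a tuple of imaginaries (false if the sorts do not match). -/
def ImFormula.Realize {ι : Type} (φ : ImFormula L M ι) (e : ι → Imag L M) : Prop :=
  ∃ v : ∀ i, Fin (φ.sort i).arity → M,
    (∀ i, e i = (φ.sort i).cls (v i)) ∧ φ.formula.Realize fun p => v p.1 p.2

variable (L M) in
/-- A formula `φ(x, a)` in an `n`-tuple `x` of variables, with the tuple `a` of parameters from
`M^eq`. -/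
structure ParamFormula (n : ℕ) where
  arity : ℕ
  formula : ImFormula L M (Fin n ⊕ Fin arity)
  params : Fin arity → Imag L M

/-- Truth of `φ(x, a)` at `b`. -/
def ParamFormula.Realize {n : ℕ} (φ : ParamFormula L M n) (b : Fin n → Imag L M) : Prop :=
  φ.formula.Realize (Sum.elim b φ.params)

/-- The parameters of the formula lie in `A`. -/
def ParamFormula.IsOver {n : ℕ} (φ : ParamFormula L M n) (A : Set (Imag L M)) : Prop :=
  ∀ i, φ.params i ∈ A

/-! ### Automorphisms acting on imaginaries -/

/-- The action of an automorphism of `M` on `M^eq`. -/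
def Imag.map (σ : M ≃[L] M) (e : Imag L M) : Imag L M :=
  ⟨e.1, Quotient.map' (s₁ := e.1.setoid) (s₂ := e.1.setoid) (fun a => σ ∘ a) (by
    intro a b h
    have h' : e.1.rel.Realize (Sum.elim a b) := h
    have := (StrongHomClass.realize_formula σ e.1.rel).2 h'
    rw [Sum.comp_elim] at this
    exact this) e.2⟩

theorem Imag.map_mk (σ : M ≃[L] M) (S : ImSort L M) (a : Fin S.arity → M) :
    Imag.map σ (S.cls a) = S.cls (σ ∘ a) := rfl

theorem Imag.map_symm_map (σ : M ≃[L] M) (e : Imag L M) : Imag.map σ.symm (Imag.map σ e) = e := by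
  obtain ⟨S, q⟩ := e
  induction q using Quotient.inductionOn with
  | _ a =>
    change S.cls (σ.symm ∘ σ ∘ a) = S.cls a
    congr 1
    funext i
    simp

theorem Imag.map_map_symm (σ : M ≃[L] M) (e : Imag L M) : Imag.map σ (Imag.map σ.symm e) = e := by
  obtain ⟨S, q⟩ := e
  induction q using Quotient.inductionOn with
  | _ a =>
    change S.cls (σ ∘ σ.symm ∘ a) = S.cls a
    congr 1
    funext i
    simp

theorem ImFormula.Realize.map {ι : Type} {φ : ImFormula L M ι} {e : ι → Imag L M}
    (σ : M ≃[L] M) (h : φ.Realize e) : φ.Realize (fun i => Imag.map σ (e i)) := by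
  obtain ⟨v, hv, hφ⟩ := h
  refine ⟨fun i => σ ∘ v i, fun i => ?_, ?_⟩
  · change Imag.map σ (e i) = _
    rw [hv i, Imag.map_mk]
  · exact (StrongHomClass.realize_formula σ φ.formula).2 hφ

/-- The action of an automorphism on formulas with parameters. -/
def ParamFormula.map {n : ℕ} (σ : M ≃[L] M) (φ : ParamFormula L M n) : ParamFormula L M n :=
  ⟨φ.arity, φ.formula, fun i => Imag.map σ (φ.params i)⟩

theorem ParamFormula.Realize.map {n : ℕ} {φ : ParamFormula L M n} {b : Fin n → Imag L M}
    (σ : M ≃[L] M) (h : φ.Realize b) : (φ.map σ).Realize (fun i => Imag.map σ (b i)) := by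
  have := ImFormula.Realize.map σ h
  have e : (fun i => Imag.map σ (Sum.elim b φ.params i)) =
      Sum.elim (fun i => Imag.map σ (b i)) (φ.map σ).params := by
    funext i
    cases i <;> rfl
  rw [e] at this
  exact this

theorem ParamFormula.map_map_symm {n : ℕ} (σ : M ≃[L] M) (φ : ParamFormula L M n) :
    (φ.map σ.symm).map σ = φ := by
  cases φ
  simp [ParamFormula.map, Imag.map_map_symm]

/-! ### Types -/

variable (L M) in
/-- A complete type in `n` variables over a set `dom` of imaginaries, as the set of the formulas
over `dom` that some tuple of `M^eq` satisfies. (In a monster model, every complete type over a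
small set arises so.) -/
@[ext]
structure CompleteType (n : ℕ) where
  dom : Set (Imag L M)
  formulas : Set (ParamFormula L M n)
  realized : ∃ b : Fin n → Imag L M, formulas = {φ | φ.IsOver dom ∧ φ.Realize b}

/-- The type `tp(b/A)`. -/
def tp {n : ℕ} (b : Fin n → Imag L M) (A : Set (Imag L M)) : CompleteType L M n where
  dom := A
  formulas := {φ | φ.IsOver A ∧ φ.Realize b}
  realized := ⟨b, rfl⟩

/-- The image of a type under an automorphism. -/
def CompleteType.map {n : ℕ} (σ : M ≃[L] M) (p : CompleteType L M n) : CompleteType L M n where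
  dom := Imag.map σ '' p.dom
  formulas := ParamFormula.map σ '' p.formulas
  realized := by
    obtain ⟨b, hb⟩ := p.realized
    refine ⟨fun i => Imag.map σ (b i), ?_⟩
    rw [hb]
    ext φ
    constructor
    · rintro ⟨ψ, ⟨h1, h2⟩, rfl⟩
      exact ⟨fun i => ⟨_, h1 i, rfl⟩, h2.map σ⟩
    · rintro ⟨h1, h2⟩
      refine ⟨φ.map σ.symm, ⟨fun i => ?_, ?_⟩, ParamFormula.map_map_symm σ φ⟩
      · obtain ⟨e, he, hi⟩ := h1 i
        change Imag.map σ.symm (φ.params i) ∈ p.dom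
        rw [← hi, Imag.map_symm_map]
        exact he
      · have := h2.map σ.symm
        simpa only [Imag.map_symm_map] using this

/-- The set of realizations of a type. -/
def CompleteType.realizations {n : ℕ} (p : CompleteType L M n) : Set (Fin n → Imag L M) :=
  {b | ∀ φ ∈ p.formulas, φ.Realize b}

/-- A type is algebraic if it has only finitely many realizations (in the monster model). -/
def CompleteType.IsAlgebraic {n : ℕ} (p : CompleteType L M n) : Prop :=
  p.realizations.Finite

/-- `q` extends `p`. -/
def CompleteType.Extends {n : ℕ} (q p : CompleteType L M n) : Prop :=
  p.dom ⊆ q.dom ∧ p.formulas ⊆ q.formulas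

/-! ### Thorn-forking -/

/-- The family `{δ(x, a)}`, `a ∈ Y`, is `k`-inconsistent: no `k` of its members (for `k` different
parameters) are satisfied together. -/
def KInconsistent {n l : ℕ} (k : ℕ) (δ : ImFormula L M (Fin n ⊕ Fin l))
    (Y : Set (Fin l → Imag L M)) : Prop :=
  ∀ s : Finset (Fin l → Imag L M), ↑s ⊆ Y → s.card = k →
    ¬ ∃ x : Fin n → Imag L M, ∀ a ∈ s, δ.Realize (Sum.elim x a)

/-- `δ(x, a)` strongly divides over `A`: the type `tp(a/A)` is not algebraic, and the family of
the `δ(x, a')`, for `a'` realizing `tp(a/A)`, is `k`-inconsistent for some `k`. -/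
def ParamFormula.StronglyDivides {n : ℕ} (δ : ParamFormula L M n) (A : Set (Imag L M)) : Prop :=
  ¬ (tp δ.params A).IsAlgebraic ∧
    ∃ k : ℕ, KInconsistent k δ.formula (tp δ.params A).realizations

/-- `δ(x, a)` þ-divides over `A`: it strongly divides over `A ∪ c` for some finite tuple `c`. -/
def ParamFormula.ThornDivides {n : ℕ} (δ : ParamFormula L M n) (A : Set (Imag L M)) : Prop :=
  ∃ (r : ℕ) (c : Fin r → Imag L M), δ.StronglyDivides (A ∪ Set.range c)

/-- A formula þ-forks over `A`: it implies a finite disjunction of formulas that þ-divide over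
`A`. -/
def ParamFormula.ThornForks {n : ℕ} (φ : ParamFormula L M n) (A : Set (Imag L M)) : Prop :=
  ∃ (N : ℕ) (δ : Fin N → ParamFormula L M n), (∀ j, (δ j).ThornDivides A) ∧
    ∀ x : Fin n → Imag L M, φ.Realize x → ∃ j, (δ j).Realize x

/-- A type þ-forks over `A`: some formula in it þ-forks over `A`. -/
def CompleteType.ThornForks {n : ℕ} (p : CompleteType L M n) (A : Set (Imag L M)) : Prop :=
  ∃ φ ∈ p.formulas, φ.ThornForks A

/-! ### Rosy types, coordinatization -/

/-- A set of imaginaries is small: it has fewer than `κ` elements. -/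
def IsSmall (κ : Cardinal.{w}) (A : Set (Imag L M)) : Prop :=
  #A < Cardinal.lift.{max u v} κ

/-- `q` satisfies local character for þ-forking: it does not þ-fork over some subset of its
domain of size at most `|T|`. -/
def CompleteType.LocalCharacter {n : ℕ} (q : CompleteType L M n) : Prop :=
  ∃ B : Set (Imag L M), B ⊆ q.dom ∧ #B ≤ Cardinal.lift.{w} (theoryCard L) ∧ ¬ q.ThornForks B

/-- A complete type `p` (over a small set) is rosy: all its extensions to complete types over
small sets satisfy local character for þ-forking. -/
def CompleteType.IsRosy {n : ℕ} (κ : Cardinal.{w}) (p : CompleteType L M n) : Prop :=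
  IsSmall κ p.dom ∧
    ∀ q : CompleteType L M n, IsSmall κ q.dom → q.Extends p → q.LocalCharacter

/-- The theory of `M` is finitely coordinatized by the set `P` of types: `P` is closed under
automorphisms, and for every finite tuple `a` of imaginaries there are finite tuples
`a₀ = ∅, a₁, …, a_N = a` such that `tp(a_{i+1}/a_i) ∈ P` for all `i < N`. -/
def FinitelyCoordinatized (P : ∀ n : ℕ, Set (CompleteType L M n)) : Prop :=
  (∀ (n : ℕ) (σ : M ≃[L] M), ∀ p ∈ P n, p.map σ ∈ P n) ∧
    ∀ (m : ℕ) (a : Fin m → Imag L M),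
      ∃ (N : ℕ) (s : ℕ → Σ n : ℕ, Fin n → Imag L M),
        s 0 = ⟨0, Fin.elim0⟩ ∧ s N = ⟨m, a⟩ ∧
          ∀ i < N, tp (s (i + 1)).2 (Set.range (s i).2) ∈ P (s (i + 1)).1

/-! ### Thorn-ranks and rosy theories -/

/-- `þ(φ, Δ, Θ, k) ≥ α`, where `X` is the set of solutions of the formula `φ(x)`, the formulas in
`Δ` are in the variables `x; y`, and those in `Θ` are in the variables `y; z`. By recursion:
* the rank is `≥ 0` if `X` is not empty;
* it is `≥ α + 1` if for some `δ ∈ Δ`, `θ ∈ Θ` and parameters `c`, the family of the `δ(x, a)` for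
  `a` with `θ(a, c)` is `k`-inconsistent, and the rank of `φ ∧ δ(x, a)` is `≥ α` for infinitely many
  of these `a`;
* for a limit `α`, it is `≥ α` if it is `≥ β` for all `β < α`. -/
noncomputable def ThornRankGE {n l r : ℕ} (Δ : Finset (ImFormula L M (Fin n ⊕ Fin l)))
    (Θ : Finset (ImFormula L M (Fin l ⊕ Fin r))) (k : ℕ) (α : Ordinal.{max u v w}) :
    Set (Fin n → Imag L M) → Prop :=
  Ordinal.limitRecOn (motive := fun _ => Set (Fin n → Imag L M) → Prop) α
    (fun X => X.Nonempty)
    (fun _ ih X => ∃ δ ∈ Δ, ∃ θ ∈ Θ, ∃ c : Fin r → Imag L M,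
      {a : Fin l → Imag L M | θ.Realize (Sum.elim a c) ∧
        ih (X ∩ {x | δ.Realize (Sum.elim x a)})}.Infinite ∧
      KInconsistent k δ {a | θ.Realize (Sum.elim a c)})
    (fun α _ ih X => ∀ (β : Ordinal.{max u v w}) (hβ : β < α), ih β hβ X)

variable (L M) in
/-- The theory of the monster model `M` is rosy: all þ-ranks `þ(φ, Δ, Θ, k)`, for formulas `φ`
with parameters, finite sets of formulas `Δ`, `Θ` and `k : ℕ`, are defined, that is, they are not
`≥ α` for all ordinals `α`. -/
def IsRosy : Prop :=
  ∀ (n l r : ℕ) (φ : ParamFormula L M n) (Δ : Finset (ImFormula L M (Fin n ⊕ Fin l)))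
    (Θ : Finset (ImFormula L M (Fin l ⊕ Fin r))) (k : ℕ),
    ∃ α : Ordinal.{max u v w}, ¬ ThornRankGE Δ Θ k α {x | φ.Realize x}

end Thorn

/-! The proof goes through local character of þ-forking for all types over small sets.

Coordinatization yields local character by left transitivity (`IsMonster.not_thornForks_trans`): if
tp(a/B) does not þ-fork over A and tp(e/Ba) does not þ-fork over Aa, then tp(e/B) does not þ-fork
over A. Its core is `IsMonster.noDiv_trans`. Let δ(x,b) strongly divide over Ac and hold at e. If b
is not algebraic over Aac, then δ(x,b) still strongly divides over Aac, which is excluded for e. If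
b is algebraic over Aac, then a formula saying of x that b is one of boundedly many solutions of a
formula over Acx strongly divides over Ac and holds at a, which is excluded for a. Along a
coordinatizing chain, local character then passes from each tuple to the next
(`IsMonster.localCharacter_of_rosy`).

If T is not rosy, some rank is ≥ every ordinal; that it is ≥ every natural number is enough.
Compactness then gives a jointly consistent sequence of formulas δ_i(x,a_i) of length |T|⁺, each
strongly dividing over all earlier parameters and some c_i (`IsMonster.exists_dividing_sequence`).
For a common realization b, local character provides a base of size at most |T|. It lies in a proper
initial segment, so a later δ_i(x,a_i) þ-divides over it, a contradiction.

Compactness works with definable sets instead of types: strong dividing is restated in terms of such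
sets (`IsMonster.stronglyDivides_iff`), and counting, k-inconsistency and finite approximations of
the rank are definable in families (`DefFam`). -/

namespace Thorn

variable {L : FirstOrder.Language.{u, v}} {M : Type w} [L.Structure M]

section

/-! ### Definable predicates on tuples of imaginaries -/

/-- The tuple `e` of imaginaries has the tuple `S` of sorts. -/
def HasSort {ι : Type} (S : ι → ImSort L M) (e : ι → Imag L M) : Prop :=
  ∀ i, (e i).1 = S i

/-- The tuple of classes of a tuple of representatives. -/
def clsTuple {ι : Type} (S : ι → ImSort L M) (v : (Σ i, Fin (S i).arity) → M) : ι → Imag L M :=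
  fun i => (S i).cls fun t => v ⟨i, t⟩

theorem hasSort_clsTuple {ι : Type} (S : ι → ImSort L M) (v : (Σ i, Fin (S i).arity) → M) :
    HasSort S (clsTuple S v) := fun _ => rfl

theorem HasSort.exists_rep {ι : Type} {S : ι → ImSort L M} {e : ι → Imag L M}
    (h : HasSort S e) : ∃ v, e = clsTuple S v := by
  have : ∀ i, ∃ a : Fin (S i).arity → M, e i = (S i).cls a := by
    intro i
    rw [← h i]
    refine ⟨(e i).2.out, ?_⟩
    change e i = ⟨(e i).1, _⟩
    rw [Quotient.out_eq]
    rfl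
  choose a ha using this
  exact ⟨fun p => a p.1 p.2, funext ha⟩

theorem ImSort.cls_eq_cls (S : ImSort L M) (a b : Fin S.arity → M) :
    S.cls a = S.cls b ↔ S.rel.Realize (Sum.elim a b) := by
  constructor
  · intro h
    have : (Quotient.mk S.setoid a) = Quotient.mk S.setoid b := eq_of_heq (Sigma.mk.inj h).2
    exact Quotient.exact this
  · intro h
    exact congrArg (Sigma.mk S) (Quotient.sound (s := S.setoid) h)

/-- A predicate on tuples of imaginaries is definable without parameters on every sort. -/
def EDef {ι : Type} (P : (ι → Imag L M) → Prop) : Prop :=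
  ∀ S : ι → ImSort L M, Set.Definable (∅ : Set M) L {v | P (clsTuple S v)}

namespace EDef

variable {ι κ : Type}

theorem congr {P Q : (ι → Imag L M) → Prop} (h : EDef P) (hPQ : ∀ e, Q e ↔ P e) : EDef Q := by
  have : Q = P := funext fun e => propext (hPQ e)
  rwa [this]

theorem const (p : Prop) : EDef (fun _ : ι → Imag L M => p) := by
  intro S
  by_cases hp : p
  · simp [hp]
  · simp [hp]

theorem and {P Q : (ι → Imag L M) → Prop} (hP : EDef P) (hQ : EDef Q) :
    EDef fun e => P e ∧ Q e := fun S => (hP S).inter (hQ S)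

theorem not {P : (ι → Imag L M) → Prop} (hP : EDef P) : EDef fun e => ¬ P e :=
  fun S => (hP S).compl

theorem or {P Q : (ι → Imag L M) → Prop} (hP : EDef P) (hQ : EDef Q) :
    EDef fun e => P e ∨ Q e := fun S => (hP S).union (hQ S)

theorem imp {P Q : (ι → Imag L M) → Prop} (hP : EDef P) (hQ : EDef Q) :
    EDef fun e => P e → Q e :=
  (hP.not.or hQ).congr fun _ => imp_iff_not_or

theorem all {γ : Type*} [Finite γ] {P : γ → (ι → Imag L M) → Prop} (hP : ∀ j, EDef (P j)) :
    EDef fun e => ∀ j, P j e := by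
  intro S
  have := Set.definable_iInter_of_finite (fun j => hP j S)
  refine cast (congrArg _ ?_) this
  ext v
  simp

theorem ex {γ : Type*} [Finite γ] {P : γ → (ι → Imag L M) → Prop} (hP : ∀ j, EDef (P j)) :
    EDef fun e => ∃ j, P j e :=
  (all fun j => (hP j).not).not.congr fun _ => by simp

theorem reindex {P : (ι → Imag L M) → Prop} (hP : EDef P) (f : ι → κ) :
    EDef fun e : κ → Imag L M => P (e ∘ f) := fun S =>
  (hP (S ∘ f)).preimage_comp (fun p : Σ i, Fin (S (f i)).arity => (⟨f p.1, p.2⟩ : Σ i, Fin (S i).arity))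

theorem hasSort [Finite ι] (S : ι → ImSort L M) : EDef (HasSort S) := by
  intro S'
  by_cases h : S' = S
  · subst h
    convert Set.definable_univ
    ext v
    simp [hasSort_clsTuple]
  · convert Set.definable_empty
    ext v
    simp only [Set.mem_ofPred_eq, Set.mem_empty_iff_false, iff_false]
    exact fun h' => h (funext fun i => h' i)

theorem eq (i j : ι) : EDef fun e : ι → Imag L M => e i = e j := by
  intro S
  have key : ∀ T : ImSort L M, Set.Definable (∅ : Set M) L
      {v : (Fin T.arity ⊕ Fin T.arity) → M | T.cls (v ∘ Sum.inl) = T.cls (v ∘ Sum.inr)} := by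
    intro T
    rw [Set.empty_definable_iff]
    refine ⟨T.rel, ?_⟩
    ext v
    simp only [Set.mem_ofPred_eq, ImSort.cls_eq_cls]
    rw [Sum.elim_comp_inl_inr]
  by_cases h : S i = S j
  · have : ∀ (A B : ImSort L M) (hAB : A = B) (f : Fin A.arity → Σ i, Fin (S i).arity)
        (g : Fin B.arity → Σ i, Fin (S i).arity), Set.Definable (∅ : Set M) L
          {v : (Σ i, Fin (S i).arity) → M | A.cls (v ∘ f) = B.cls (v ∘ g)} := by
      rintro A _ rfl f g
      exact (key A).preimage_comp (Sum.elim f g)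
    exact this _ _ h (fun t => ⟨i, t⟩) (fun t => ⟨j, t⟩)
  · convert Set.definable_empty
    ext v
    simp only [Set.mem_ofPred_eq, Set.mem_empty_iff_false, iff_false]
    exact fun h' => h (congrArg Sigma.fst h')

/-- Quantifiers must stay within fixed sorts: a quantifier over all of `M^eq` would range over
infinitely many sorts and need not be first-order. -/
theorem exists_sorted [Finite ι] [Finite κ] {P : (ι ⊕ κ → Imag L M) → Prop} (hP : EDef P)
    (S : κ → ImSort L M) : EDef fun e => ∃ y, HasSort S y ∧ P (Sum.elim e y) := by
  intro S'
  have h1 := hP (Sum.elim S' S)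
  have h2 := h1.image_comp
    (fun p : Σ i, Fin (S' i).arity => (⟨Sum.inl p.1, p.2⟩ : Σ i, Fin (Sum.elim S' S i).arity))
  convert h2 using 1
  ext v
  simp only [Set.mem_ofPred_eq, Set.mem_image]
  constructor
  · rintro ⟨y, hy, hP'⟩
    obtain ⟨z, rfl⟩ := hy.exists_rep
    refine ⟨fun p => match p with
      | ⟨Sum.inl i, t⟩ => v ⟨i, t⟩
      | ⟨Sum.inr i, t⟩ => z ⟨i, t⟩, ?_, ?_⟩
    · convert hP' using 1
      funext i
      cases i <;> rfl
    · rfl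
  · rintro ⟨x, hx, rfl⟩
    refine ⟨fun i => clsTuple (Sum.elim S' S) x (Sum.inr i), fun i => rfl, ?_⟩
    convert hx using 1
    funext i
    cases i <;> rfl

end EDef

/-! ### Formulas of `M^eq` as definable predicates -/

theorem ImFormula.realize_iff {ι : Type} (φ : ImFormula L M ι) (e : ι → Imag L M) :
    φ.Realize e ↔ ∃ v, e = clsTuple φ.sort v ∧ φ.formula.Realize v := by
  constructor
  · rintro ⟨v, hv, h⟩
    exact ⟨fun p => v p.1 p.2, funext hv, h⟩
  · rintro ⟨v, rfl, h⟩
    exact ⟨fun i t => v ⟨i, t⟩, fun _ => rfl, h⟩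

theorem ImFormula.Realize.hasSort {ι : Type} {φ : ImFormula L M ι} {e : ι → Imag L M}
    (h : φ.Realize e) : HasSort φ.sort e := by
  obtain ⟨v, rfl, -⟩ := (φ.realize_iff e).1 h
  exact hasSort_clsTuple _ _

/-- On its own sorts the formula says that some equivalent representatives satisfy `φ.formula`, a
projection of a definable set; on all other sorts it is false. Unlike `ImFormula`, the predicates
`EDef` are closed under negation. -/
theorem ImFormula.eDef {ι : Type} [Finite ι] (φ : ImFormula L M ι) : EDef φ.Realize := by
  intro S
  by_cases h : S = φ.sort
  · subst h
    have h1 : Set.Definable (∅ : Set M) L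
        {v : (Σ i : ι ⊕ ι, Fin (Sum.elim φ.sort φ.sort i).arity) → M |
          (∀ i : ι, clsTuple (Sum.elim φ.sort φ.sort) v (Sum.inl i) =
            clsTuple (Sum.elim φ.sort φ.sort) v (Sum.inr i))} :=
      (EDef.all (fun i : ι => EDef.eq (L := L) (M := M) (Sum.inl i : ι ⊕ ι) (Sum.inr i)))
        (Sum.elim φ.sort φ.sort)
    have h2 : Set.Definable (∅ : Set M) L {v : (Σ i, Fin (φ.sort i).arity) → M |
        φ.formula.Realize v} := Set.empty_definable_iff.2 ⟨_, rfl⟩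
    have h3 := h2.preimage_comp
      (fun p : Σ i, Fin (φ.sort i).arity =>
        (⟨Sum.inr p.1, p.2⟩ : Σ i : ι ⊕ ι, Fin (Sum.elim φ.sort φ.sort i).arity))
    have h4 := (h1.inter h3).image_comp
      (fun p : Σ i, Fin (φ.sort i).arity =>
        (⟨Sum.inl p.1, p.2⟩ : Σ i : ι ⊕ ι, Fin (Sum.elim φ.sort φ.sort i).arity))
    convert h4 using 1
    ext v
    simp only [Set.mem_ofPred_eq, Set.mem_image, ImFormula.realize_iff]
    constructor
    · rintro ⟨z, hz, hφ⟩
      refine ⟨fun p => match p with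
        | ⟨Sum.inl i, t⟩ => v ⟨i, t⟩
        | ⟨Sum.inr i, t⟩ => z ⟨i, t⟩, ⟨fun i => congrFun hz i, hφ⟩, rfl⟩
    · rintro ⟨x, ⟨hx1, hx2⟩, rfl⟩
      exact ⟨fun p => x ⟨Sum.inr p.1, p.2⟩, funext fun i => hx1 i, hx2⟩
  · convert Set.definable_empty
    ext v
    simp only [Set.mem_ofPred_eq, Set.mem_empty_iff_false, iff_false]
    exact fun h' => h (funext fun i => h'.hasSort i)

theorem EDef.exists_imFormula {ι : Type} {P : (ι → Imag L M) → Prop} (hP : EDef P)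
    (S : ι → ImSort L M) :
    ∃ φ : ImFormula L M ι, φ.sort = S ∧ ∀ e, φ.Realize e ↔ HasSort S e ∧ P e := by
  obtain ⟨θ, hθ⟩ := Set.empty_definable_iff.1 (hP S)
  have hθ' : ∀ v, P (clsTuple S v) ↔ θ.Realize v := fun v => Set.ext_iff.1 hθ v
  refine ⟨⟨S, θ⟩, rfl, fun e => ?_⟩
  rw [ImFormula.realize_iff]
  constructor
  · rintro ⟨v, rfl, h⟩
    exact ⟨hasSort_clsTuple _ _, (hθ' v).2 h⟩
  · rintro ⟨h1, h2⟩
    obtain ⟨v, rfl⟩ := h1.exists_rep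
    exact ⟨v, rfl, (hθ' v).1 h2⟩

end

section

/-! ### Definability with parameters -/

/-- A predicate on tuples of imaginaries is definable over `A` on every sort. -/
def ADef {ι : Type} (A : Set (Imag L M)) (P : (ι → Imag L M) → Prop) : Prop :=
  ∃ (κ : Type) (_ : Finite κ) (d : κ → Imag L M) (Q : (ι ⊕ κ → Imag L M) → Prop),
    (∀ i, d i ∈ A) ∧ EDef Q ∧ ∀ x, P x ↔ Q (Sum.elim x d)

theorem EDef.aDef {ι : Type} {P : (ι → Imag L M) → Prop} (h : EDef P) (A : Set (Imag L M)) :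
    ADef A P :=
  ⟨Empty, inferInstance, Empty.elim, fun z => P (z ∘ Sum.inl), fun i => i.elim, h.reindex _,
    fun _ => Iff.rfl⟩

namespace ADef

variable {ι κ : Type} {A B : Set (Imag L M)}

theorem congr {P Q : (ι → Imag L M) → Prop} (h : ADef A P) (hPQ : ∀ e, Q e ↔ P e) :
    ADef A Q := by
  have : Q = P := funext fun e => propext (hPQ e)
  rwa [this]

theorem mono {P : (ι → Imag L M) → Prop} (h : ADef A P) (hAB : A ⊆ B) : ADef B P := by
  obtain ⟨κ, _, d, Q, hd, hQ, h⟩ := h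
  exact ⟨κ, ‹_›, d, Q, fun i => hAB (hd i), hQ, h⟩

theorem not {P : (ι → Imag L M) → Prop} (h : ADef A P) : ADef A fun e => ¬ P e := by
  obtain ⟨κ, _, d, Q, hd, hQ, h⟩ := h
  exact ⟨κ, ‹_›, d, fun z => ¬ Q z, hd, hQ.not, fun x => not_congr (h x)⟩

theorem all {γ : Type*} [Finite γ] {P : γ → (ι → Imag L M) → Prop} (h : ∀ j, ADef A (P j)) :
    ADef A fun e => ∀ j, P j e := by
  suffices H : ∀ (m : ℕ) (R : Fin m → (ι → Imag L M) → Prop), (∀ j, ADef A (R j)) →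
      ADef A fun e => ∀ j, R j e by
    obtain ⟨m, ⟨ε⟩⟩ := Finite.exists_equiv_fin γ
    exact (H m (fun j => P (ε.symm j)) fun j => h _).congr fun e =>
      ⟨fun h' j => h' _, fun h' j => by simpa using h' (ε j)⟩
  clear h P
  intro m P h
  choose κ hκ d Q hd hQ h using h
  refine ⟨Σ j, κ j, inferInstance, fun p => d p.1 p.2,
    fun z => ∀ j, Q j (Sum.elim (z ∘ Sum.inl) fun i => z (Sum.inr ⟨j, i⟩)), fun p => hd _ _,
    EDef.all fun j => ?_, fun x => forall_congr' fun j => h j x⟩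
  refine ((hQ j).reindex (Sum.elim Sum.inl fun i => Sum.inr ⟨j, i⟩)).congr fun e => ?_
  rw [Sum.comp_elim]
  rfl

theorem and {P Q : (ι → Imag L M) → Prop} (hP : ADef A P) (hQ : ADef A Q) :
    ADef A fun e => P e ∧ Q e :=
  (all (γ := Bool) (P := fun b => cond b P Q) (by rintro ⟨⟩ <;> assumption)).congr
    fun _ => by simp [and_comm]

theorem imp {P Q : (ι → Imag L M) → Prop} (hP : ADef A P) (hQ : ADef A Q) :
    ADef A fun e => P e → Q e :=
  (hP.and hQ.not).not.congr fun _ => by simp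

theorem reindex {P : (ι → Imag L M) → Prop} (hP : ADef A P) (f : ι → κ) :
    ADef A fun e : κ → Imag L M => P (e ∘ f) := by
  obtain ⟨κ', _, d, Q, hd, hQ, h⟩ := hP
  refine ⟨κ', ‹_›, d, fun z => Q (z ∘ Sum.map f id), hd, hQ.reindex _, fun x => ?_⟩
  beta_reduce
  rw [h, Sum.elim_comp_map]
  rfl

theorem subst [Finite κ] {P : (ι ⊕ κ → Imag L M) → Prop} (hP : ADef A P) {d : κ → Imag L M}
    (hd : ∀ i, d i ∈ A) : ADef A fun e : ι → Imag L M => P (Sum.elim e d) := by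
  obtain ⟨κ', _, d', Q, hd', hQ, h⟩ := hP
  refine ⟨κ ⊕ κ', inferInstance, Sum.elim d d', fun z => Q (z ∘ (Equiv.sumAssoc ι κ κ')),
    by rintro (i | i); exacts [hd i, hd' i], hQ.reindex _, fun x => ?_⟩
  beta_reduce
  rw [h]
  apply iff_of_eq
  congr 1
  funext i
  rcases i with (i | i) | i <;> rfl

/-- Parameters of a definable set that lie in a finite tuple can be made explicit. -/
theorem split {P : (ι → Imag L M) → Prop} {a : κ → Imag L M} (hP : ADef (A ∪ Set.range a) P) :
    ∃ Y : (ι ⊕ κ → Imag L M) → Prop, ADef A Y ∧ ∀ x, P x ↔ Y (Sum.elim x a) := by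
  classical
  obtain ⟨κ', _, d, Q, hd, hQ, h⟩ := hP
  have hd' : ∀ i : {i // d i ∉ A}, ∃ j, a j = d i := fun i => (hd i).resolve_left i.2
  choose f hf using hd'
  refine ⟨fun z => Q (Sum.elim (z ∘ Sum.inl) fun i => if h : d i ∈ A then d i else
      z (Sum.inr (f ⟨i, h⟩))),
    ⟨{i // d i ∈ A}, inferInstance, fun i => d i, fun z => Q (z ∘ Sum.elim (Sum.inl ∘ Sum.inl)
      fun i => if h : d i ∈ A then Sum.inr ⟨i, h⟩ else Sum.inl (Sum.inr (f ⟨i, h⟩))),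
      fun i => i.2, hQ.reindex _, fun x => ?_⟩, fun x => ?_⟩
  · apply iff_of_eq
    beta_reduce
    congr 1
    funext i
    rcases i with i | i
    · rfl
    · by_cases hi : d i ∈ A <;> simp [hi]
  · rw [h]
    apply iff_of_eq
    beta_reduce
    congr 1
    funext i
    rcases i with i | i
    · rfl
    · simp [hf]

theorem exists_sorted [Finite ι] [Finite κ] {P : (ι ⊕ κ → Imag L M) → Prop} (hP : ADef A P)
    (S : κ → ImSort L M) : ADef A fun e => ∃ y, HasSort S y ∧ P (Sum.elim e y) := by
  obtain ⟨κ', _, d, Q, hd, hQ, h⟩ := hP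
  let g : (ι ⊕ κ) ⊕ κ' → (ι ⊕ κ') ⊕ κ :=
    Sum.elim (Sum.elim (Sum.inl ∘ Sum.inl) Sum.inr) (Sum.inl ∘ Sum.inr)
  refine ⟨κ', ‹_›, d, _, hd, (hQ.reindex g).exists_sorted S, fun x => ?_⟩
  refine exists_congr fun y => and_congr_right fun _ => ?_
  rw [h]
  apply iff_of_eq
  congr 1
  funext i
  rcases i with (i | i) | i <;> rfl

end ADef

/-- A definable predicate on a fixed sort is given by a formula with parameters. -/
theorem ADef.exists_paramFormula {n : ℕ} {A : Set (Imag L M)} {P : (Fin n → Imag L M) → Prop}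
    (hP : ADef A P) (S : Fin n → ImSort L M) :
    ∃ φ : ParamFormula L M n, φ.IsOver A ∧ ∀ e, φ.Realize e ↔ HasSort S e ∧ P e := by
  obtain ⟨κ, _, d, Q, hd, hQ, h⟩ := hP
  obtain ⟨m, ⟨ε⟩⟩ := Finite.exists_equiv_fin κ
  obtain ⟨φ, hφ, hφ'⟩ := (hQ.reindex (Sum.map id ε)).exists_imFormula
    (Sum.elim S fun j => (d (ε.symm j)).1)
  refine ⟨⟨m, φ, d ∘ ε.symm⟩, fun i => hd _, fun e => ?_⟩
  change φ.Realize (Sum.elim e _) ↔ _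
  rw [hφ', h, Sum.elim_comp_map, Function.comp_assoc, Equiv.symm_comp_self]
  refine and_congr_left fun _ => ⟨fun h i => h (Sum.inl i), fun h i => ?_⟩
  rcases i with i | i
  · exact h i
  · rfl

theorem ParamFormula.aDef {n : ℕ} {A : Set (Imag L M)} {φ : ParamFormula L M n}
    (h : φ.IsOver A) : ADef A φ.Realize :=
  ⟨Fin φ.arity, inferInstance, φ.params, φ.formula.Realize, h, φ.formula.eDef, fun _ => Iff.rfl⟩

/-- The family of the sorts of a tuple. -/
def sortOf {ι : Type} (e : ι → Imag L M) : ι → ImSort L M := fun i => (e i).1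

theorem hasSort_sortOf {ι : Type} (e : ι → Imag L M) : HasSort (sortOf e) e := fun _ => rfl

/-- A predicate over `A` becomes a formula once it is restricted to the sorts of `b`, and `b`
satisfies that restriction. So types can be handled through definable predicates alone. -/
theorem mem_realizations_tp {n : ℕ} {b e : Fin n → Imag L M} {A : Set (Imag L M)} :
    e ∈ (tp b A).realizations ↔ ∀ P, ADef A P → P b → P e := by
  constructor
  · intro h P hP hb
    obtain ⟨φ, hφ, hφ'⟩ := hP.exists_paramFormula (sortOf b)
    exact ((hφ' e).1 (h φ ⟨hφ, (hφ' b).2 ⟨hasSort_sortOf b, hb⟩⟩)).2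
  · rintro h φ ⟨h1, h2⟩
    exact h _ (ParamFormula.aDef h1) h2

/-! ### Saturation for imaginaries -/

variable {κ : Cardinal.{w}}

theorem IsMonster.aleph0_lt (hM : IsMonster L κ M) : ℵ₀ < κ := by
  have h := hM.large
  have h1 : (ℵ₀ : Cardinal.{max u v w}) ≤ Cardinal.lift.{w} (theoryCard L) := by
    exact aleph0_le_lift.2 (le_max_left _ _)
  have h2 := (h1.trans (Order.le_succ _)).trans_lt h
  rw [← lift_aleph0.{w, max u v}] at h2
  simpa using h2

theorem IsSmall.mono {A B : Set (Imag L M)} (hB : IsSmall κ B) (h : A ⊆ B) : IsSmall κ A :=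
  (mk_le_mk_of_subset h).trans_lt hB

theorem IsMonster.isSmall_of_finite (hM : IsMonster L κ M) {A : Set (Imag L M)} (hA : A.Finite) :
    IsSmall κ A := by
  refine hA.lt_aleph0.trans ?_
  simpa using hM.aleph0_lt

theorem IsMonster.isSmall_of_le (hM : IsMonster L κ M) {A : Set (Imag L M)}
    (hA : #A ≤ Order.succ (Cardinal.lift.{w} (theoryCard L))) : IsSmall κ A :=
  hA.trans_lt hM.large

theorem IsMonster.isSmall_union (hM : IsMonster L κ M) {A B : Set (Imag L M)} (hA : IsSmall κ A)
    (hB : IsSmall κ B) : IsSmall κ (A ∪ B) := by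
  refine (mk_union_le A B).trans_lt (add_lt_of_lt ?_ hA hB)
  simpa using hM.aleph0_lt.le

theorem IsMonster.isSmall_union_range (hM : IsMonster L κ M) {A : Set (Imag L M)}
    (hA : IsSmall κ A) {ι : Type} [Finite ι] (c : ι → Imag L M) : IsSmall κ (A ∪ Set.range c) :=
  hM.isSmall_union hA (hM.isSmall_of_finite (Set.finite_range c))

/-- A finitely satisfiable family of predicates definable over a small set, on a fixed finite tuple
of sorts, is satisfiable. -/
theorem IsMonster.exists_realization (hM : IsMonster L κ M) {A : Set (Imag L M)}
    (hA : IsSmall κ A) {ι : Type} [Finite ι] (S : ι → ImSort L M) {J : Type*}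
    (C : J → (ι → Imag L M) → Prop) (hC : ∀ j, ADef A (C j))
    (hfin : ∀ s : Finset J, ∃ x, HasSort S x ∧ ∀ j ∈ s, C j x) :
    ∃ x, HasSort S x ∧ ∀ j, C j x := by
  classical
  let rep : ∀ e : Imag L M, Fin e.1.arity → M := fun e => e.2.out
  have hrep : ∀ e : Imag L M, e = e.1.cls (rep e) := fun e => by
    change e = ⟨e.1, _⟩
    rw [Quotient.out_eq]
    rfl
  -- Each imaginary contributes finitely many coordinates of one representative, so the set of real
  -- parameters stays small because `κ` is uncountable.
  let R : Set M := Set.range fun p : Σ e : A, Fin e.1.1.arity => rep p.1 p.2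
  have hR : #R < κ := by
    have h1 : Cardinal.lift.{max u v w} #R ≤ Cardinal.lift.{w} #(Σ e : A, Fin e.1.1.arity) :=
      mk_range_le_lift
    have h2 : #(Σ e : A, Fin e.1.1.arity) ≤ #A * ℵ₀ := by
      rw [mk_sigma]
      refine (sum_le_sum _ (fun _ => ℵ₀) fun _ => ?_).trans ?_
      · exact (by simp)
      · simp
    have hκ : ℵ₀ < Cardinal.lift.{max u v} κ := by simpa using hM.aleph0_lt
    have h3 := h2.trans_lt (mul_lt_of_lt hκ.le hA hκ)
    have h4 : Cardinal.lift.{max u v w} #R < Cardinal.lift.{max u v w} κ := by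
      refine h1.trans_lt ?_
      have := lift_lt.{_, w}.2 h3
      simpa using this
    exact lift_lt.1 h4
  obtain ⟨N, ⟨ε⟩⟩ := Finite.exists_equiv_fin (Σ i, Fin (S i).arity)
  have hdef : ∀ j, ∃ φ : L[[R]].Formula (Fin N), ∀ v, φ.Realize v ↔ C j (clsTuple S (v ∘ ε)) := by
    intro j
    obtain ⟨κ', _, d, Q, hd, hQ, h⟩ := hC j
    obtain ⟨θ, hθ⟩ := Set.empty_definable_iff.1 (hQ (Sum.elim S (sortOf d)))
    have hθ' : ∀ v, Q (clsTuple (Sum.elim S (sortOf d)) v) ↔ θ.Realize v :=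
      fun v => Set.ext_iff.1 hθ v
    have hD : Set.Definable R L {v : Fin N → M | C j (clsTuple S (v ∘ ε))} := by
      rw [Set.definable_iff_exists_formula_sum]
      refine ⟨θ.relabel (fun p => match p with
        | ⟨Sum.inl i, t⟩ => Sum.inr (ε ⟨i, t⟩)
        | ⟨Sum.inr i, t⟩ => Sum.inl ⟨rep (d i) t, ⟨⟨⟨d i, hd i⟩, t⟩, rfl⟩⟩), ?_⟩
      ext v
      simp only [Set.mem_ofPred_eq, h, Formula.realize_relabel, ← hθ']
      apply iff_of_eq
      congr 1
      funext i
      rcases i with i | i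
      · rfl
      · exact hrep (d i)
    obtain ⟨φ, hφ⟩ := hD
    exact ⟨φ, fun v => (Set.ext_iff.1 hφ v).symm⟩
  choose Φ hΦ using hdef
  obtain ⟨v, hv⟩ := hM.saturated R hR N (Set.range Φ) (by
    intro s hs
    obtain ⟨x, hx, hx'⟩ := hfin (s.attach.image fun p => (hs p.2).choose)
    obtain ⟨v, rfl⟩ := hx.exists_rep
    refine ⟨v ∘ ε.symm, fun φ hφ => ?_⟩
    have h1 := hx' (hs hφ).choose (Finset.mem_image.2 ⟨⟨φ, hφ⟩, Finset.mem_attach _ _, rfl⟩)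
    have h2 : Φ (hs hφ).choose = φ := (hs hφ).choose_spec
    rw [← h2, hΦ, Function.comp_assoc, Equiv.symm_comp_self]
    exact h1)
  exact ⟨_, hasSort_clsTuple S (v ∘ ε), fun j => (hΦ j v).1 (hv _ ⟨j, rfl⟩)⟩

end

section

variable {κ : Cardinal.{w}}

/-! ### Definability of counting and of `k`-inconsistency -/

theorem exists_finset_card_iff {α : Type*} (m : ℕ) (p : α → Prop) :
    (∃ s : Finset α, s.card = m ∧ ∀ a ∈ s, p a) ↔
      ∃ f : Fin m → α, Function.Injective f ∧ ∀ i, p (f i) := by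
  classical
  constructor
  · rintro ⟨s, hs, h⟩
    exact ⟨fun i => ((s.equivFinOfCardEq hs).symm i : α),
      fun i j hij => (s.equivFinOfCardEq hs).symm.injective (Subtype.ext hij),
      fun i => h _ ((s.equivFinOfCardEq hs).symm i).2⟩
  · rintro ⟨f, hf, h⟩
    refine ⟨Finset.univ.map ⟨f, hf⟩, by simp, fun a ha => ?_⟩
    obtain ⟨i, -, rfl⟩ := Finset.mem_map.1 ha
    exact h i

theorem exists_finset_card_mono {α : Type*} {m m' : ℕ} (hm : m ≤ m') {p q : α → Prop}
    (hpq : ∀ a, p a → q a) (h : ∃ s : Finset α, s.card = m' ∧ ∀ a ∈ s, p a) :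
    ∃ s : Finset α, s.card = m ∧ ∀ a ∈ s, q a := by
  obtain ⟨s, rfl, hs⟩ := h
  obtain ⟨t, ht, rfl⟩ := Finset.exists_subset_card_eq hm
  exact ⟨t, rfl, fun a ha => hpq a (hs a (ht ha))⟩

theorem infinite_iff_forall_finset {α : Type*} {s : Set α} :
    s.Infinite ↔ ∀ m, ∃ t : Finset α, t.card = m ∧ ∀ a ∈ t, a ∈ s := by
  constructor
  · intro h m
    obtain ⟨t, ht, hm⟩ := h.exists_subset_card_eq m
    exact ⟨t, hm, fun a ha => ht ha⟩
  · intro h hs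
    obtain ⟨t, ht, hts⟩ := h (hs.toFinset.card + 1)
    have := Finset.card_le_card (s := t) (t := hs.toFinset) fun a ha => hs.mem_toFinset.2 (hts a ha)
    omega

/-- A property of sets of tuples that is definable in families. -/
def DefFam {ν : Type} (Φ : Set (ν → Imag L M) → Prop) : Prop :=
  ∀ (ι : Type) [Finite ι] (Q : (ν ⊕ ι → Imag L M) → Prop), EDef Q →
    EDef fun u : ι → Imag L M => Φ {a | Q (Sum.elim a u)}

theorem DefFam.aDef {ν ι : Type} [Finite ι] {Φ : Set (ν → Imag L M) → Prop} (hΦ : DefFam Φ)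
    {A : Set (Imag L M)} {W : (ν ⊕ ι → Imag L M) → Prop} (hW : ADef A W) :
    ADef A fun u : ι → Imag L M => Φ {a | W (Sum.elim a u)} := by
  obtain ⟨κ, _, d, Q, hd, hQ, h⟩ := hW
  refine ⟨κ, ‹_›, d, _, hd, hΦ (ι ⊕ κ) _ (hQ.reindex (Equiv.sumAssoc ν ι κ)), fun x => ?_⟩
  refine iff_of_eq (congrArg Φ (Set.ext fun a => ?_))
  simp only [Set.mem_ofPred_eq, h]
  apply iff_of_eq
  congr 1
  funext i
  rcases i with (i | i) | i <;> rfl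

theorem DefFam.exists_card {ν : Type} [Finite ν] (S : ν → ImSort L M) (m : ℕ) :
    DefFam fun Y : Set (ν → Imag L M) =>
      ∃ s : Finset (ν → Imag L M), s.card = m ∧ ∀ a ∈ s, HasSort S a ∧ a ∈ Y := by
  intro ι _ Q hQ
  have h1 : EDef fun z : ι ⊕ (Fin m × ν) → Imag L M =>
      (∀ i j, i ≠ j → ∃ t, ¬ z (Sum.inr (i, t)) = z (Sum.inr (j, t))) ∧
        ∀ i, Q (z ∘ Sum.elim (fun t => Sum.inr (i, t)) Sum.inl) :=
    (EDef.all fun i => EDef.all fun j => (EDef.const _).imp (EDef.ex fun t =>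
      (EDef.eq _ _).not)).and (EDef.all fun i => hQ.reindex _)
  refine (h1.exists_sorted fun p => S p.2).congr fun u => ?_
  refine (exists_finset_card_iff _ _).trans ?_
  constructor
  · rintro ⟨f, hf, h⟩
    refine ⟨fun p => f p.1 p.2, fun p => (h p.1).1 p.2, fun i j hij => ?_, fun i => ?_⟩
    · by_contra! hall
      exact hij (hf (funext hall))
    · have := (h i).2
      rw [Sum.comp_elim]
      exact this
  · rintro ⟨y, hy, h2, h3⟩
    refine ⟨fun i t => y (i, t), fun i j hij => ?_, fun i => ⟨fun t => hy (i, t), ?_⟩⟩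
    · by_contra hne
      obtain ⟨t, ht⟩ := h2 i j hne
      exact ht (congrFun hij t)
    · have := h3 i
      rw [Sum.comp_elim] at this
      exact this

theorem exists_hasSort [Nonempty M] {ι : Type} (S : ι → ImSort L M) : ∃ e, HasSort S e :=
  ⟨_, hasSort_clsTuple S fun _ => Classical.arbitrary M⟩

theorem ImFormula.Realize.hasSort_inl {ι κ : Type} {φ : ImFormula L M (ι ⊕ κ)} {x : ι → Imag L M}
    {y : κ → Imag L M} (h : φ.Realize (Sum.elim x y)) : HasSort (φ.sort ∘ Sum.inl) x :=
  fun i => h.hasSort (Sum.inl i)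

theorem ImFormula.Realize.hasSort_inr {ι κ : Type} {φ : ImFormula L M (ι ⊕ κ)} {x : ι → Imag L M}
    {y : κ → Imag L M} (h : φ.Realize (Sum.elim x y)) : HasSort (φ.sort ∘ Sum.inr) y :=
  fun i => h.hasSort (Sum.inr i)

theorem kInconsistent_iff [Nonempty M] {n l k : ℕ} {δ : ImFormula L M (Fin n ⊕ Fin l)}
    {Y : Set (Fin l → Imag L M)} : KInconsistent k δ Y ↔
      ¬ ∃ x, HasSort (δ.sort ∘ Sum.inl) x ∧ ∃ s : Finset (Fin l → Imag L M), s.card = k ∧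
        ∀ a ∈ s, HasSort (δ.sort ∘ Sum.inr) a ∧ a ∈ Y ∧ δ.Realize (Sum.elim x a) := by
  constructor
  · rintro h ⟨x, -, s, hs, hx⟩
    exact h s (fun a ha => (hx a ha).2.1) hs ⟨x, fun a ha => (hx a ha).2.2⟩
  · rintro h s hsY hs ⟨x, hx⟩
    -- For `k = 0` no member of the family fixes the sorts of `x`; a tuple of the right sorts exists
    -- because `M` is nonempty.
    rcases s.eq_empty_or_nonempty with rfl | ⟨a, ha⟩
    · obtain ⟨x', hx'⟩ := exists_hasSort (δ.sort ∘ Sum.inl)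
      exact h ⟨x', hx', ∅, hs, by simp⟩
    · exact h ⟨x, (hx a ha).hasSort_inl, s, hs, fun a ha =>
        ⟨(hx a ha).hasSort_inr, hsY ha, hx a ha⟩⟩

theorem KInconsistent.mono {n l k : ℕ} {δ : ImFormula L M (Fin n ⊕ Fin l)}
    {Y Z : Set (Fin l → Imag L M)} (h : KInconsistent k δ Y) (hZ : Z ⊆ Y) : KInconsistent k δ Z :=
  fun s hs => h s (hs.trans hZ)

theorem DefFam.kInconsistent [Nonempty M] {n l : ℕ} (k : ℕ) (δ : ImFormula L M (Fin n ⊕ Fin l)) :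
    DefFam (KInconsistent k δ) := by
  intro ι _ Q hQ
  have h1 : EDef fun w : Fin l ⊕ (ι ⊕ Fin n) → Imag L M =>
      Q (w ∘ Sum.map id Sum.inl) ∧
      δ.Realize (w ∘ Sum.elim (Sum.inr ∘ Sum.inr) Sum.inl) := (hQ.reindex _).and (δ.eDef.reindex _)
  have h2 := ((DefFam.exists_card (δ.sort ∘ Sum.inr) k _ _ h1).exists_sorted
    (δ.sort ∘ Sum.inl)).not
  refine h2.congr fun u => ?_
  rw [kInconsistent_iff]
  simp only [Set.mem_ofPred_eq, Sum.comp_elim, Sum.elim_comp_map]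
  rfl

/-! ### Strong dividing in terms of definable sets -/

/-- Strong dividing over `A`, as a property of the definable sets over `A`. -/
def SDiv {n : ℕ} (A : Set (Imag L M)) (δ : ParamFormula L M n) : Prop :=
  (∀ X, ADef A X → X δ.params → {y | X y}.Infinite) ∧
    ∃ k X, ADef A X ∧ X δ.params ∧ KInconsistent k δ.formula {y | X y}

theorem aDef_eq_const {ι : Type} {A : Set (Imag L M)} (i : ι) {e : Imag L M} (he : e ∈ A) :
    ADef A fun z : ι → Imag L M => z i = e :=
  (((EDef.eq (Sum.inl i) (Sum.inr ())).aDef A).subst (ι := ι) (d := fun _ : Unit => e)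
    fun _ => he).congr fun _ => Iff.rfl

theorem aDef_eq_tuple {ι : Type} [Finite ι] {A : Set (Imag L M)} {f : ι → Imag L M}
    (hf : ∀ i, f i ∈ A) : ADef A fun z : ι → Imag L M => z = f :=
  (ADef.all fun i => aDef_eq_const i (hf i)).congr fun _ => funext_iff

variable [Nonempty M]

/-- Compactness in both clauses. If no single definable set around the parameter were
`k`-inconsistent, saturation would give `k` distinct realizations of the type with a common
solution. If all such sets are infinite, saturation gives a realization outside any finite set. -/
theorem IsMonster.stronglyDivides_iff (hM : IsMonster L κ M) {n : ℕ} {A : Set (Imag L M)}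
    (hA : IsSmall κ A) (δ : ParamFormula L M n) : δ.StronglyDivides A ↔ SDiv A δ := by
  classical
  constructor
  · rintro ⟨h1, k, h2⟩
    refine ⟨fun X hX hb hfin => h1 (hfin.subset fun y hy => mem_realizations_tp.1 hy X hX hb),
      k, ?_⟩
    by_contra! hcon
    let J := {X : (Fin δ.arity → Imag L M) → Prop // ADef A X ∧ X δ.params}
    let C : J → (Fin n ⊕ (Fin k × Fin δ.arity) → Imag L M) → Prop := fun X z =>
      (∀ i, X.1 (z ∘ fun t => Sum.inr (i, t))) ∧
      (∀ i j, i ≠ j → ∃ t, ¬ z (Sum.inr (i, t)) = z (Sum.inr (j, t))) ∧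
      ∀ i, δ.formula.Realize (z ∘ Sum.elim Sum.inl fun t => Sum.inr (i, t))
    obtain ⟨z, -, hz⟩ := hM.exists_realization hA
      (Sum.elim (δ.formula.sort ∘ Sum.inl) fun p => δ.formula.sort (Sum.inr p.2)) C
      (fun X => (ADef.all fun i => X.2.1.reindex _).and (((EDef.all fun i => EDef.all fun j =>
        (EDef.const _).imp (EDef.ex fun t => (EDef.eq _ _).not)).and
        (EDef.all fun i => δ.formula.eDef.reindex _)).aDef A)) (by
      intro s
      have h3 := hcon (fun y => ∀ X : s, X.1.1 y) (ADef.all fun X => X.1.2.1) fun X => X.1.2.2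
      rw [kInconsistent_iff, not_not] at h3
      obtain ⟨x, hx, h4⟩ := h3
      obtain ⟨f, hf, h5⟩ := (exists_finset_card_iff _ _).1 h4
      refine ⟨Sum.elim x fun p => f p.1 p.2, ?_, fun X hX => ⟨fun i => ?_, fun i j hij => ?_,
        fun i => ?_⟩⟩
      · rintro (i | i)
        · exact hx i
        · exact (h5 i.1).1 i.2
      · exact (h5 i).2.1 ⟨X, hX⟩
      · by_contra! hall
        exact hij (hf (funext hall))
      · rw [Sum.comp_elim]
        exact (h5 i).2.2)
    -- The trivial predicate serves only to extract the conjuncts that do not depend on `X`.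
    have hd := (hz ⟨fun _ => True, (EDef.const True).aDef A, trivial⟩).2
    have h7 : ∃ f : Fin k → Fin δ.arity → Imag L M, Function.Injective f ∧ ∀ i,
        f i ∈ (tp δ.params A).realizations ∧
          δ.formula.Realize (Sum.elim (z ∘ Sum.inl) (f i)) := by
      refine ⟨fun i t => z (Sum.inr (i, t)), fun i j hij => ?_, fun i => ⟨?_, ?_⟩⟩
      · by_contra hne
        obtain ⟨t, ht⟩ := hd.1 i j hne
        exact ht (congrFun hij t)
      · exact mem_realizations_tp.2 fun P hP hb => (hz ⟨P, hP, hb⟩).1 i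
      · have := hd.2 i
        rwa [Sum.comp_elim] at this
    obtain ⟨s, hs, h6⟩ := (exists_finset_card_iff k fun a =>
      a ∈ (tp δ.params A).realizations ∧ δ.formula.Realize (Sum.elim (z ∘ Sum.inl) a)).2 h7
    exact h2 s (fun a ha => (h6 a ha).1) hs ⟨_, fun a ha => (h6 a ha).2⟩
  · rintro ⟨h1, k, X, hX, hb, hk⟩
    refine ⟨fun hfin => ?_, k, hk.mono fun y hy => mem_realizations_tp.1 hy X hX hb⟩
    have hfin' : (tp δ.params A).realizations.Finite := hfin
    let F := hfin'.toFinset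
    let E : Set (Imag L M) := ⋃ f ∈ F, Set.range f
    have hFE : ∀ f ∈ F, ∀ i, f i ∈ E := fun f hf i => Set.mem_biUnion hf (Set.mem_range_self i)
    have hE : E.Finite := F.finite_toSet.biUnion fun f _ => Set.finite_range f
    let J := {X : (Fin δ.arity → Imag L M) → Prop // ADef A X ∧ X δ.params}
    obtain ⟨z, -, hz⟩ := hM.exists_realization (hM.isSmall_union hA (hM.isSmall_of_finite hE))
      (sortOf δ.params) (fun (X : J) z => X.1 z ∧ ∀ f : F, ¬ z = f.1)
      (fun X => (X.2.1.mono Set.subset_union_left).and (ADef.all fun f => (aDef_eq_tuple fun i =>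
        Or.inr (hFE f.1 f.2 i)).not)) (by
      intro s
      -- The sorts are part of the predicate: an infinite set could otherwise have its new elements
      -- in other sorts, where saturation does not apply.
      have h3 := h1 (fun y => HasSort (sortOf δ.params) y ∧ ∀ X : s, X.1.1 y)
        (((EDef.hasSort _).aDef A).and (ADef.all fun X => X.1.2.1))
        ⟨hasSort_sortOf _, fun X => X.1.2.2⟩
      obtain ⟨y, hy, hyF⟩ := h3.exists_notMem_finset F
      refine ⟨y, hy.1, fun X hX => ⟨hy.2 ⟨X, hX⟩, fun f hf => hyF (hf ▸ f.2)⟩⟩)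
    have hzF : z ∈ F := hfin'.mem_toFinset.2 (mem_realizations_tp.2 fun P hP hb =>
      (hz ⟨P, hP, hb⟩).1)
    exact (hz ⟨fun _ => True, (EDef.const True).aDef A, trivial⟩).2 ⟨z, hzF⟩ rfl

/-- Thorn-dividing only depends on finitely many elements of the base. -/
theorem IsMonster.thornDivides_of_subset (hM : IsMonster L κ M) {n : ℕ} {A B : Set (Imag L M)}
    (hAB : A ⊆ B) (hB : IsSmall κ B) {δ : ParamFormula L M n} (h : δ.ThornDivides B) :
    δ.ThornDivides A := by
  obtain ⟨r, c, h⟩ := h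
  rw [hM.stronglyDivides_iff (hM.isSmall_union_range hB c)] at h
  obtain ⟨h1, k, X, ⟨κ', _, d, Q, hd, hQ, h⟩, hb, hk⟩ := h
  obtain ⟨N, ⟨ε⟩⟩ := Finite.exists_equiv_fin κ'
  have hr : Set.range (d ∘ ε.symm) = Set.range d := ε.symm.surjective.range_comp d
  -- The finitely many parameters of the `k`-inconsistent set `X` become the new tuple `c`;
  -- non-algebraicity passes down to the smaller base.
  refine ⟨N, d ∘ ε.symm, ?_⟩
  rw [hM.stronglyDivides_iff (hM.isSmall_union_range (hB.mono hAB) _), hr]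
  refine ⟨fun Y hY => h1 Y (hY.mono (Set.union_subset (hAB.trans Set.subset_union_left) ?_)), k, X,
    ⟨κ', ‹_›, d, Q, fun i => Or.inr ⟨i, rfl⟩, hQ, h⟩, hb, hk⟩
  rintro _ ⟨i, rfl⟩
  exact hd i

theorem IsMonster.thornForks_of_subset (hM : IsMonster L κ M) {n : ℕ} {A B : Set (Imag L M)}
    (hAB : A ⊆ B) (hB : IsSmall κ B) {p : CompleteType L M n} (h : p.ThornForks B) :
    p.ThornForks A := by
  obtain ⟨φ, hφ, N, δ, hδ, himp⟩ := h
  exact ⟨φ, hφ, N, δ, fun j => hM.thornDivides_of_subset hAB hB (hδ j), himp⟩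

end

section

variable {κ : Cardinal.{w}}

/-! ### Equality of types -/

/-- `a` and `b` have the same type over `A`. -/
def TEq {ι : Type} (A : Set (Imag L M)) (a b : ι → Imag L M) : Prop :=
  ∀ P, ADef A P → P a → P b

namespace TEq

variable {ι ι' : Type} {A B : Set (Imag L M)} {a b : ι → Imag L M}

theorem symm (h : TEq A a b) : TEq A b a := fun P hP hb => by
  by_contra ha
  exact h _ hP.not ha hb

theorem mono (h : TEq B a b) (hAB : A ⊆ B) : TEq A a b := fun P hP => h P (hP.mono hAB)

theorem comp (h : TEq A a b) (f : ι' → ι) : TEq A (a ∘ f) (b ∘ f) :=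
  fun _ hP => h _ (hP.reindex f)

end TEq


/-- A finite tuple can be moved along an equality of types. -/
theorem IsMonster.exists_tEq (hM : IsMonster L κ M) {A : Set (Imag L M)} (hA : IsSmall κ A)
    {ι ι' : Type} [Finite ι] [Finite ι'] {a b : ι → Imag L M} (h : TEq A a b)
    (f : ι' → Imag L M) : ∃ g : ι' → Imag L M, TEq A (Sum.elim a f) (Sum.elim b g) := by
  let J := {P : (ι ⊕ ι' → Imag L M) → Prop // ADef A P ∧ P (Sum.elim a f)}
  obtain ⟨g, -, hg⟩ := hM.exists_realization (hM.isSmall_union_range hA b) (sortOf f)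
    (fun (P : J) y => P.1 (Sum.elim b y)) (fun P => by
      refine (((P.2.1.mono Set.subset_union_left).reindex Sum.swap).subst
        (ι := ι') (κ := ι) (d := b) fun i => Or.inr (Set.mem_range_self i)).congr fun e => ?_
      refine iff_of_eq (congrArg P.1 ?_)
      funext i
      rcases i with i | i <;> rfl) (by
    intro s
    obtain ⟨y, hy, h'⟩ := h _ ((ADef.all fun P : s => P.1.2.1).exists_sorted (sortOf f))
      ⟨f, hasSort_sortOf f, fun P => P.1.2.2⟩
    exact ⟨y, hy, fun P hP => h' ⟨P, hP⟩⟩)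
  exact ⟨g, fun P hP ha => hg ⟨P, hP, ha⟩⟩

/-! ### Tuples avoiding dividing formulas -/

/-- No formula with parameters in `B` that strongly divides over `A` together with a finite tuple of
`B` holds at `e`. -/
def NoDiv {n : ℕ} (e : Fin n → Imag L M) (A B : Set (Imag L M)) : Prop :=
  ∀ (δ : ParamFormula L M n) (r : ℕ) (c : Fin r → Imag L M), δ.IsOver B → (∀ i, c i ∈ B) →
    δ.StronglyDivides (A ∪ Set.range c) → ¬ δ.Realize e

/-- Compactness: `NoDiv` omits a set of formulas over the small set `B`. Either this is consistent
with `Ps`, or finitely many members of `Ps` imply a finite disjunction of dividing formulas, which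
is þ-forking. -/
theorem IsMonster.exists_noDiv_or (hM : IsMonster L κ M) {n : ℕ} {A B : Set (Imag L M)}
    (hB : IsSmall κ B) (S : Fin n → ImSort L M) (Ps : Set ((Fin n → Imag L M) → Prop))
    (hPs : ∀ P ∈ Ps, ADef B P) :
    (∃ e, HasSort S e ∧ (∀ P ∈ Ps, P e) ∧ NoDiv e A B) ∨
    ∃ F : Finset ((Fin n → Imag L M) → Prop), ↑F ⊆ Ps ∧
      ∃ (N : ℕ) (δ : Fin N → ParamFormula L M n) (r : Fin N → ℕ)
        (c : ∀ j, Fin (r j) → Imag L M), (∀ j, (δ j).IsOver B) ∧ (∀ j i, c j i ∈ B) ∧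
        (∀ j, (δ j).StronglyDivides (A ∪ Set.range (c j))) ∧
        ∀ x, HasSort S x → (∀ P ∈ F, P x) → ∃ j, (δ j).Realize x := by
  classical
  by_contra! hcon
  obtain ⟨hcon1, hcon2⟩ := hcon
  let D := {q : ParamFormula L M n × (Σ r : ℕ, Fin r → Imag L M) // q.1.IsOver B ∧
    (∀ i, q.2.2 i ∈ B) ∧ q.1.StronglyDivides (A ∪ Set.range q.2.2)}
  obtain ⟨e, he, hC⟩ := hM.exists_realization hB S
    (Sum.elim (fun P : Ps => P.1) fun (q : D) x => ¬ q.1.1.Realize x) (by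
      rintro (P | q)
      · exact hPs P.1 P.2
      · exact (ParamFormula.aDef q.2.1).not) (by
    intro s
    let ε := s.toRight.equivFin
    obtain ⟨x, hx, h1, h2⟩ := hcon2 (s.toLeft.image Subtype.val) (by
        intro P hP
        obtain ⟨Q, -, rfl⟩ := Finset.mem_image.1 hP
        exact Q.2) _ (fun j => (ε.symm j).1.1.1) (fun j => (ε.symm j).1.1.2.1)
      (fun j => (ε.symm j).1.1.2.2) (fun j => (ε.symm j).1.2.1) (fun j => (ε.symm j).1.2.2.1)
      (fun j => (ε.symm j).1.2.2.2)
    refine ⟨x, hx, ?_⟩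
    rintro (P | q) hj
    · exact h1 _ (Finset.mem_image.2 ⟨P, Finset.mem_toLeft.2 hj, rfl⟩)
    · have := h2 (ε ⟨q, Finset.mem_toRight.2 hj⟩)
      rwa [Equiv.symm_apply_apply] at this)
  exact hcon1 e he (fun P hP => hC (Sum.inl ⟨P, hP⟩)) fun δ r c h1 h2 h3 =>
    hC (Sum.inr ⟨⟨δ, ⟨r, c⟩⟩, h1, h2, h3⟩)

variable [Nonempty M]

/-- Having at least `m` solutions and being `k`-inconsistent are definable in families, so both
clauses of strong dividing are visible in the type of the parameters. -/
theorem SDiv.transfer {n : ℕ} {ι : Type} [Finite ι] {A : Set (Imag L M)} {δ : ParamFormula L M n}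
    {p : Fin δ.arity → Imag L M} {g g' : ι → Imag L M}
    (h : TEq A (Sum.elim δ.params g) (Sum.elim p g')) (hδ : SDiv (A ∪ Set.range g) δ) :
    SDiv (A ∪ Set.range g') (⟨δ.arity, δ.formula, p⟩ : ParamFormula L M n) := by
  obtain ⟨h1, k, X, hX, hb, hk⟩ := hδ
  constructor
  · intro X hX hb
    change X p at hb
    obtain ⟨Y, hY, hXY⟩ := hX.split
    have hs : HasSort (sortOf p) δ.params := fun i =>
      (h.symm _ ((EDef.hasSort (Sum.elim (sortOf p) (sortOf g'))).aDef A)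
        (by rintro (i | i) <;> rfl)) (Sum.inl i)
    rw [infinite_iff_forall_finset]
    intro m
    have hc := (DefFam.exists_card (sortOf p) m).aDef hY
    have h2 := h _ ((hY.imp (hc.reindex Sum.inr)).congr fun _ => Iff.rfl) ?_ ((hXY p).1 hb)
    · obtain ⟨s, hs, h3⟩ := h2
      exact ⟨s, hs, fun a ha => (hXY a).2 (h3 a ha).2⟩
    · intro h3
      have h4 := h1 (fun y => HasSort (sortOf p) y ∧ Y (Sum.elim y g))
        (((EDef.hasSort _).aDef _).and ((hY.mono Set.subset_union_left).subst
          fun i => Or.inr ⟨i, rfl⟩)) ⟨hs, h3⟩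
      exact infinite_iff_forall_finset.1 h4 m
  · obtain ⟨Y, hY, hXY⟩ := hX.split
    have h2 := h _ (hY.and (((DefFam.kInconsistent k δ.formula).aDef hY).reindex Sum.inr))
      ⟨(hXY _).1 hb, hk.mono fun y hy => (hXY y).2 hy⟩
    exact ⟨k, fun y => Y (Sum.elim y g'), (hY.mono Set.subset_union_left).subst
      fun i => Or.inr ⟨i, rfl⟩, h2.1, h2.2⟩

/-- The cases are whether the parameter of `δ` is algebraic over `A`, `a` and `c`. If not, `δ` still
strongly divides over this larger base, against `he`. If it is, the algebraicity is turned into a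
formula about `a` that strongly divides over `A` and `c`, against `ha`. -/
theorem IsMonster.noDiv_trans (hM : IsMonster L κ M) {n m : ℕ} {A B : Set (Imag L M)}
    (hAB : A ⊆ B) (hB : IsSmall κ B) {a : Fin n → Imag L M} {e : Fin m → Imag L M}
    (ha : NoDiv a A B) (he : NoDiv e (A ∪ Set.range a) (B ∪ Set.range a)) : NoDiv e A B := by
  classical
  intro δ r c hδ hc hdiv hreal
  have hA := hB.mono hAB
  rw [hM.stronglyDivides_iff (hM.isSmall_union_range hA c)] at hdiv
  obtain ⟨h1, k, X₀, hX₀, hX₀b, hk⟩ := hdiv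
  by_cases h : ∀ X, ADef (A ∪ Set.range a ∪ Set.range c) X → X δ.params → {y | X y}.Infinite
  · refine he δ r c (fun i => Or.inl (hδ i)) (fun i => Or.inl (hc i)) ?_ hreal
    rw [hM.stronglyDivides_iff (hM.isSmall_union_range (hM.isSmall_union_range hA a) c)]
    exact ⟨h, k, X₀, hX₀.mono (Set.union_subset_union_left _ Set.subset_union_left), hX₀b, hk⟩
  · push Not at h
    obtain ⟨X, hX, hXb, hXfin⟩ := h
    rw [Set.union_right_comm] at hX
    obtain ⟨Y, ⟨κ', _, d, Q, hd, hQ, hYQ⟩, hXY⟩ := hX.split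
    obtain ⟨N, ⟨ε⟩⟩ := Finite.exists_equiv_fin (Fin δ.arity ⊕ κ')
    -- The parameters `d` lie in `A ∪ Set.range c`. Adjoining them to `δ.params` leaves no hidden
    -- parameters in `χ` and keeps the type over that base non-algebraic.
    let w : Fin N → Imag L M := Sum.elim δ.params d ∘ ε.symm
    let m₀ := hXfin.toFinset.card + 1
    -- `Z (x, y, z)`: `y` is one of fewer than `m₀` solutions of `Q (y, x, z)`
    have hcard := DefFam.exists_card (sortOf δ.params) m₀ (Fin n ⊕ κ') _
      (hQ.reindex (Equiv.sumAssoc (Fin δ.arity) (Fin n) κ'))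
    have hZ := (hQ.reindex (κ := Fin n ⊕ Fin N) (Sum.elim (Sum.elim (Sum.inr ∘ ε ∘ Sum.inl)
      Sum.inl) (Sum.inr ∘ ε ∘ Sum.inr))).and
      (hcard.reindex (κ := Fin n ⊕ Fin N) (Sum.map id (ε ∘ Sum.inr))).not
    obtain ⟨χ, hχs, hχ⟩ := hZ.exists_imFormula (Sum.elim (sortOf a) (sortOf w))
    have hassoc : ∀ (y : Fin δ.arity → Imag L M) (x : Fin n → Imag L M) (z : κ' → Imag L M),
        Sum.elim y (Sum.elim x z) ∘ (Equiv.sumAssoc (Fin δ.arity) (Fin n) κ') =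
          Sum.elim (Sum.elim y x) z := by
      intro y x z
      funext i
      rcases i with (i | i) | i <;> rfl
    have hχ' : ∀ x z, χ.Realize (Sum.elim x z) ↔ HasSort (Sum.elim (sortOf a) (sortOf w))
        (Sum.elim x z) ∧ Q (Sum.elim (Sum.elim (z ∘ ε ∘ Sum.inl) x) (z ∘ ε ∘ Sum.inr)) ∧
        ¬ ∃ s : Finset (Fin δ.arity → Imag L M), s.card = m₀ ∧ ∀ y ∈ s,
          HasSort (sortOf δ.params) y ∧ Q (Sum.elim (Sum.elim y x) (z ∘ ε ∘ Sum.inr)) := by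
      intro x z
      rw [hχ]
      simp only [Sum.comp_elim, Sum.elim_comp_map, Function.comp_id, Set.mem_ofPred_eq, hassoc]
      rfl
    have hw1 : w ∘ ε ∘ Sum.inl = δ.params := by
      funext i
      simp [w]
    have hw2 : w ∘ ε ∘ Sum.inr = d := by
      funext i
      simp [w]
    refine ha ⟨N, χ, w⟩ r c ?_ hc ?_ ?_
    · intro i
      change Sum.elim δ.params d (ε.symm i) ∈ B
      rcases ε.symm i with j | j
      · exact hδ j
      · rcases hd j with hj | ⟨t, ht⟩
        · exact hAB hj
        · exact (show c t = Sum.elim δ.params d (Sum.inr j) from ht) ▸ hc t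
    · rw [hM.stronglyDivides_iff (hM.isSmall_union_range hA c)]
      constructor
      · intro U hU hUw
        have h2 := h1 (fun y => U (Sum.elim y d ∘ ε.symm)) ((hU.reindex ε.symm).subst hd) hUw
        refine (h2.image (f := fun y => Sum.elim y d ∘ ε.symm) ?_).mono ?_
        · intro y _ y' _ hyy'
          funext i
          have := congrFun hyy' (ε (Sum.inl i))
          simpa using this
        · rintro _ ⟨y, hy, rfl⟩
          exact hy
      -- With the `d`-part fixed, `m₀` different parameters differ in their `y`-part. A common
      -- solution `x` would give `m₀` solutions of `Q (y, x, d)`, which `χ` forbids.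
      · refine ⟨m₀, fun z => ∀ i, z (ε (Sum.inr i)) = d i, ADef.all fun i =>
          aDef_eq_const _ (hd i), fun i => congrFun hw2 i, ?_⟩
        rintro s hs hcard ⟨x, hx⟩
        have hsd : ∀ z ∈ s, z ∘ ε ∘ Sum.inr = d := fun z hz => funext (hs hz)
        obtain ⟨z₀, hz₀⟩ : s.Nonempty := Finset.card_pos.1 (by omega)
        refine ((hχ' x z₀).1 (hx z₀ hz₀)).2.2
          ⟨s.image fun z => z ∘ ε ∘ Sum.inl, ?_, fun y hy => ?_⟩
        · rw [Finset.card_image_of_injOn, hcard]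
          intro z hz z' hz' hzz'
          funext i
          obtain ⟨j, rfl⟩ := ε.surjective i
          rcases j with j | j
          · exact congrFun hzz' j
          · exact (hs hz j).trans (hs hz' j).symm
        · obtain ⟨z, hz, rfl⟩ := Finset.mem_image.1 hy
          have h3 := (hχ' x z).1 (hx z hz)
          rw [hsd z₀ hz₀, ← hsd z hz]
          refine ⟨fun i => ?_, h3.2.1⟩
          have h4 : (z (ε (Sum.inl i))).1 = (w (ε (Sum.inl i))).1 := h3.1 (Sum.inr _)
          exact h4.trans (congrArg Sigma.fst (congrFun hw1 i))
    · change χ.Realize (Sum.elim a w)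
      rw [hχ', hw1, hw2]
      refine ⟨?_, (hYQ _).1 ((hXY _).1 hXb), ?_⟩
      · rintro (i | i) <;> rfl
      · rintro ⟨s, hs, hs'⟩
        have := Finset.card_le_card (s := s) (t := hXfin.toFinset) fun y hy =>
          hXfin.mem_toFinset.2 ((hXY y).2 ((hYQ _).2 (hs' y hy).2))
        omega

end

section

variable {κ : Cardinal.{w}} [Nonempty M]

/-! ### Left transitivity of thorn-independence -/

theorem IsMonster.not_thornForks_trans (hM : IsMonster L κ M) {n m : ℕ} {A B : Set (Imag L M)}
    (hAB : A ⊆ B) (hB : IsSmall κ B) {a : Fin n → Imag L M} {e : Fin m → Imag L M}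
    (ha : ¬ (tp a B).ThornForks A)
    (he : ¬ (tp e (B ∪ Set.range a)).ThornForks (A ∪ Set.range a)) :
    ¬ (tp e B).ThornForks A := by
  classical
  rintro ⟨φ, ⟨hφB, hφe⟩, N, δ, hδ, himp⟩
  choose r c hc using hδ
  have hA := hB.mono hAB
  -- The dividing formulas implied by `φ` may have parameters outside `B`. Over `B'` they are among
  -- those that `NoDiv` excludes.
  let B' : Set (Imag L M) := B ∪ ⋃ j, (Set.range (δ j).params ∪ Set.range (c j))
  have hB' : IsSmall κ B' := hM.isSmall_union hB (hM.isSmall_of_finite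
    (Set.finite_iUnion fun j => (Set.finite_range _).union (Set.finite_range _)))
  have hBB' : B ⊆ B' := Set.subset_union_left
  obtain ⟨a', -, ha', hdiv⟩ | ⟨F, hF, N', δ', r', c', -, -, h3, h4⟩ :=
    hM.exists_noDiv_or (A := A) hB' (sortOf a) {P | ADef B P ∧ P a} fun P hP => hP.1.mono hBB'
  swap
  · obtain ⟨ψ, hψ, hψ'⟩ := (ADef.all fun P : F => (hF P.2).1).exists_paramFormula (sortOf a)
    exact ha ⟨ψ, ⟨hψ, (hψ' a).2 ⟨hasSort_sortOf a, fun P => (hF P.2).2⟩⟩, N', δ',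
      fun j => ⟨r' j, c' j, h3 j⟩, fun x hx =>
        h4 x ((hψ' x).1 hx).1 fun P hP => ((hψ' x).1 hx).2 ⟨P, hP⟩⟩
  have hT : TEq B a a' := fun P hP h => ha' P ⟨hP, h⟩
  -- Only `φ` has to hold at `e'`, not all of tp(e/B): `φ` already implies the disjunction of the `δ
  -- j`.
  obtain ⟨e', -, he', hdiv'⟩ | ⟨F, hF, N', δ', r', c', -, -, h3, h4⟩ :=
    hM.exists_noDiv_or (A := A ∪ Set.range a') (hM.isSmall_union_range hB' a') (sortOf e)
      {φ.Realize} (by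
        rintro _ rfl
        exact (ParamFormula.aDef hφB).mono (hBB'.trans Set.subset_union_left))
  · have h := hM.noDiv_trans (hAB.trans hBB') hB' hdiv hdiv'
    obtain ⟨j, hj⟩ := himp e' (he' _ rfl)
    have hsub : ∀ j, Set.range (δ j).params ∪ Set.range (c j) ⊆ B' := fun j =>
      (Set.subset_iUnion (fun j => Set.range (δ j).params ∪ Set.range (c j)) j).trans
        Set.subset_union_right
    exact h (δ j) (r j) (c j) (fun i => hsub j (Or.inl ⟨i, rfl⟩))
      (fun i => hsub j (Or.inr ⟨i, rfl⟩)) (hc j) hj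
  · let f : (Σ j, Fin (δ' j).arity ⊕ Fin (r' j)) → Imag L M :=
      fun q => Sum.elim (δ' q.1).params (c' q.1) q.2
    -- Moving `a'` back to `a` over `B` fixes `φ` and carries the dividing formulas to ones that
    -- þ-divide over `A ∪ Set.range a`, contradicting `he`.
    obtain ⟨g, hg⟩ := hM.exists_tEq hB hT.symm f
    have hsort : sortOf e = φ.formula.sort ∘ Sum.inl :=
      funext fun i => ImFormula.Realize.hasSort_inl hφe i
    refine he ⟨φ, ⟨fun i => Or.inl (hφB i), hφe⟩, N',
      fun j => ⟨(δ' j).arity, (δ' j).formula, fun i => g ⟨j, Sum.inl i⟩⟩,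
      fun j => ⟨r' j, fun i => g ⟨j, Sum.inr i⟩, ?_⟩, ?_⟩
    · have h5 := h3 j
      rw [hM.stronglyDivides_iff (hM.isSmall_union_range (hM.isSmall_union_range hA _) _),
        Set.union_assoc, ← Set.Sum.elim_range] at h5 ⊢
      refine SDiv.transfer ?_ h5
      have h6 := (hg.mono hAB).comp (Sum.elim (fun i => Sum.inr ⟨j, Sum.inl i⟩)
        (Sum.elim Sum.inl fun i => Sum.inr ⟨j, Sum.inr i⟩) :
          Fin (δ' j).arity ⊕ (Fin n ⊕ Fin (r' j)) → _)
      simp only [Sum.comp_elim] at h6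
      exact h6
    · have h5 : ADef B fun u : Fin n ⊕ (Σ j, Fin (δ' j).arity ⊕ Fin (r' j)) → Imag L M =>
          ¬ ∃ x, HasSort (sortOf e) x ∧ φ.Realize (Sum.elim u x ∘ Sum.inr) ∧
            ∀ j, ¬ (δ' j).formula.Realize (Sum.elim u x ∘
              Sum.elim Sum.inr fun i => Sum.inl (Sum.inr ⟨j, Sum.inl i⟩)) :=
        ((((ParamFormula.aDef hφB).reindex (Sum.inr)).and (ADef.all fun j =>
          (((δ' j).formula.eDef.reindex _).aDef B).not)).exists_sorted (sortOf e)).not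
      have h6 := hg _ h5 (by
        rintro ⟨x, hx, hx1, hx2⟩
        obtain ⟨j, hj⟩ := h4 x hx fun P hP => by
          rw [Set.mem_singleton_iff.1 (hF hP)]
          exact hx1
        refine hx2 j ?_
        rw [Sum.comp_elim]
        exact hj)
      intro x hx
      by_contra! hcon
      refine h6 ⟨x, hsort ▸ ImFormula.Realize.hasSort_inl hx, hx, fun j => ?_⟩
      rw [Sum.comp_elim]
      exact hcon j

/-! ### Coordinatization and local character -/

/-- The empty tuple is available without parameters. If δ(e,b) held, the set of `y` with δ(e,y)
would be definable around b, so infinite inside any `X` containing b, and `e` would refute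
`k`-inconsistency. -/
theorem IsMonster.not_thornForks_of_isEmpty (hM : IsMonster L κ M) {A B : Set (Imag L M)}
    (hA : IsSmall κ A) (e : Fin 0 → Imag L M) : ¬ (tp e B).ThornForks A := by
  rintro ⟨φ, ⟨-, hφe⟩, N, δ, hδ, himp⟩
  obtain ⟨j, hj⟩ := himp e hφe
  obtain ⟨r, c, h⟩ := hδ j
  rw [hM.stronglyDivides_iff (hM.isSmall_union_range hA _)] at h
  obtain ⟨h1, k, X, hX, hb, hk⟩ := h
  have hdef : ADef (A ∪ Set.range c) fun y => (δ j).formula.Realize (Sum.elim e y) :=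
    ((((δ j).formula.eDef.reindex Sum.swap).aDef _).subst (d := e) fun i => i.elim0).congr
      fun y => by
        refine iff_of_eq (congrArg _ (funext fun i => ?_))
        rcases i with i | i <;> rfl
  obtain ⟨s, hs, hs'⟩ := infinite_iff_forall_finset.1 (h1 _ (hX.and hdef) ⟨hb, hj⟩) k
  exact hk s (fun y hy => (hs' y hy).1) hs ⟨e, fun y hy => (hs' y hy).2⟩

/-- Rosiness of tp(e/a) is applied to its extension tp(e/Ba). The resulting base `B₁` may use
elements of `a`; these are dropped, since left transitivity supplies `a` on both sides. -/
theorem IsMonster.localCharacter_of_rosy (hM : IsMonster L κ M) {n m : ℕ} {a : Fin n → Imag L M}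
    {e : Fin m → Imag L M} (ha : ∀ B, IsSmall κ B → (tp a B).LocalCharacter)
    (he : (tp e (Set.range a)).IsRosy κ) {B : Set (Imag L M)} (hB : IsSmall κ B) :
    (tp e B).LocalCharacter := by
  obtain ⟨B₀, hB₀, hB₀c, hB₀f⟩ := ha B hB
  obtain ⟨B₁, hB₁, hB₁c, hB₁f⟩ := he.2 (tp e (B ∪ Set.range a)) (hM.isSmall_union_range hB a)
    ⟨Set.subset_union_right, fun φ hφ => ⟨fun i => Or.inr (hφ.1 i), hφ.2⟩⟩
  have hsub : B₀ ∪ B₁ ∩ B ⊆ B := Set.union_subset hB₀ Set.inter_subset_right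
  refine ⟨B₀ ∪ B₁ ∩ B, hsub, ?_, hM.not_thornForks_trans hsub hB (a := a) ?_ ?_⟩
  · refine (mk_union_le _ _).trans (add_le_of_le ?_ hB₀c
      ((mk_le_mk_of_subset Set.inter_subset_left).trans hB₁c))
    exact aleph0_le_lift.2 (le_max_left _ _)
  · exact fun h => hB₀f (hM.thornForks_of_subset Set.subset_union_left (hB.mono hsub) h)
  · refine fun h => hB₁f (hM.thornForks_of_subset ?_
      (hM.isSmall_union_range (hB.mono hsub) a) h)
    intro x hx
    rcases hB₁ hx with h | h
    · exact Or.inl (Or.inr ⟨hx, h⟩)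
    · exact Or.inr h

/-- In a theory finitely coordinatized by rosy types all types over small sets satisfy local
character. -/
theorem IsMonster.localCharacter (hM : IsMonster L κ M) {P : ∀ n : ℕ, Set (CompleteType L M n)}
    (hP : FinitelyCoordinatized P) (hrosy : ∀ n : ℕ, ∀ p ∈ P n, p.IsRosy κ) {m : ℕ}
    (a : Fin m → Imag L M) {B : Set (Imag L M)} (hB : IsSmall κ B) :
    (tp a B).LocalCharacter := by
  obtain ⟨N, s, h0, hN, hs⟩ := hP.2 m a
  have key : ∀ i ≤ N, ∀ B : Set (Imag L M), IsSmall κ B → (tp (s i).2 B).LocalCharacter := by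
    intro i
    induction i with
    | zero =>
      intro _ B hB
      rw [h0]
      exact ⟨∅, Set.empty_subset _, by simp,
        hM.not_thornForks_of_isEmpty (hM.isSmall_of_finite Set.finite_empty) _⟩
    | succ i ih =>
      intro hi B hB
      exact hM.localCharacter_of_rosy (ih (Nat.le_of_succ_le hi)) (hrosy _ _ (hs i hi)) hB
  have := key N le_rfl B hB
  rw [hN] at this
  exact this

end

section

/-! ### Finite approximations of thorn-ranks -/

/-- The finite approximation of `þ(X, Δ, Θ, k) ≥ j` that asks for `m` parameters instead of
infinitely many. -/
def FinRank {n l r : ℕ} (Δ : Finset (ImFormula L M (Fin n ⊕ Fin l)))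
    (Θ : Finset (ImFormula L M (Fin l ⊕ Fin r))) (k m : ℕ) :
    ℕ → Set (Fin n → Imag L M) → Prop
  | 0, X => X.Nonempty
  | j + 1, X => ∃ δ ∈ Δ, ∃ θ ∈ Θ, ∃ c : Fin r → Imag L M, HasSort (θ.sort ∘ Sum.inr) c ∧
      KInconsistent k δ {a | θ.Realize (Sum.elim a c)} ∧
      ∃ s : Finset (Fin l → Imag L M), s.card = m ∧ ∀ a ∈ s, HasSort (θ.sort ∘ Sum.inl) a ∧
        a ∈ {a | θ.Realize (Sum.elim a c) ∧
          FinRank Δ Θ k m j (X ∩ {x | δ.Realize (Sum.elim x a)})}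

variable {n l r : ℕ} {Δ : Finset (ImFormula L M (Fin n ⊕ Fin l))}
  {Θ : Finset (ImFormula L M (Fin l ⊕ Fin r))} {k : ℕ}

theorem ThornRankGE.finRank {m j : ℕ} {X : Set (Fin n → Imag L M)} (hm : 0 < m)
    (h : ThornRankGE Δ Θ k (j : Ordinal.{max u v w}) X) : FinRank Δ Θ k m j X := by
  induction j generalizing X with
  | zero => simpa [ThornRankGE, FinRank] using h
  | succ j ih =>
    rw [ThornRankGE, Nat.cast_succ, Ordinal.limitRecOn_add_one] at h
    obtain ⟨δ, hδ, θ, hθ, c, hinf, hk⟩ := h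
    obtain ⟨s, hs, hs'⟩ := infinite_iff_forall_finset.1 hinf m
    obtain ⟨a, ha⟩ : s.Nonempty := Finset.card_pos.1 (hs ▸ hm)
    exact ⟨δ, hδ, θ, hθ, c, (hs' a ha).1.hasSort_inr, hk, s, hs, fun a ha =>
      ⟨(hs' a ha).1.hasSort_inl, (hs' a ha).1, ih (hs' a ha).2⟩⟩

theorem FinRank.nonempty {m j : ℕ} {X : Set (Fin n → Imag L M)} (hm : 0 < m)
    (h : FinRank Δ Θ k m j X) : X.Nonempty := by
  induction j generalizing X with
  | zero => exact h
  | succ j ih =>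
    obtain ⟨δ, hδ, θ, hθ, c, -, -, s, hs, hs'⟩ := h
    obtain ⟨a, ha⟩ : s.Nonempty := Finset.card_pos.1 (hs ▸ hm)
    exact (ih (hs' a ha).2.2).mono Set.inter_subset_left

theorem FinRank.mono {m m' j j' : ℕ} {X X' : Set (Fin n → Imag L M)} (hm : m' ≤ m) (hm' : 0 < m)
    (hj : j' ≤ j) (hX : X ⊆ X') (h : FinRank Δ Θ k m j X) : FinRank Δ Θ k m' j' X' := by
  induction j' generalizing j X X' with
  | zero => exact (h.nonempty hm').mono hX
  | succ j' ih =>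
    obtain ⟨j, rfl⟩ : ∃ i, j = i + 1 := ⟨j - 1, by omega⟩
    obtain ⟨δ, hδ, θ, hθ, c, hc, hk, hs⟩ := h
    exact ⟨δ, hδ, θ, hθ, c, hc, hk, exists_finset_card_mono hm (fun a ha => ⟨ha.1, ha.2.1,
      ih (by omega) (Set.inter_subset_inter_left _ hX) ha.2.2⟩) hs⟩

/-- Demanding `m` parameters instead of infinitely many makes the rank first-order. The intersection
with a sort keeps the innermost existence quantifier within one sort. -/
theorem DefFam.finRank [Nonempty M] (S : Fin n → ImSort L M) (m j : ℕ) :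
    DefFam fun X : Set (Fin n → Imag L M) => FinRank Δ Θ k m j (X ∩ {x | HasSort S x}) := by
  induction j with
  | zero =>
    intro ι _ Q hQ
    refine ((hQ.reindex Sum.swap).exists_sorted S).congr fun u => exists_congr fun x => ?_
    rw [and_comm]
    have : Sum.elim u x ∘ Sum.swap = Sum.elim x u := by
      funext i
      rcases i with i | i <;> rfl
    rw [this]
    rfl
  | succ j ih =>
    intro ι _ Q hQ
    have key : EDef fun u : ι → Imag L M => ∃ δ : Δ, ∃ θ : Θ, ∃ c : Fin r → Imag L M,
        HasSort (θ.1.sort ∘ Sum.inr) c ∧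
        (KInconsistent k δ.1 {a | θ.1.Realize (Sum.elim a (Sum.elim u c ∘ Sum.inr))} ∧
        ∃ s : Finset (Fin l → Imag L M), s.card = m ∧ ∀ a ∈ s, HasSort (θ.1.sort ∘ Sum.inl) a ∧
          a ∈ {a | θ.1.Realize (Sum.elim a (Sum.elim u c) ∘ Sum.map id Sum.inr) ∧
            FinRank Δ Θ k m j ({x | Q (Sum.elim x (Sum.elim a (Sum.elim u c)) ∘
                Sum.map id (Sum.inr ∘ Sum.inl)) ∧
              δ.1.Realize (Sum.elim x (Sum.elim a (Sum.elim u c)) ∘ Sum.map id Sum.inl)} ∩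
              {x | HasSort S x})}) :=
      EDef.ex fun δ => EDef.ex fun θ => EDef.exists_sorted
        (P := fun z : ι ⊕ Fin r → Imag L M =>
          KInconsistent k δ.1 {a | θ.1.Realize (Sum.elim a (z ∘ Sum.inr))} ∧
          ∃ s : Finset (Fin l → Imag L M), s.card = m ∧ ∀ a ∈ s, HasSort (θ.1.sort ∘ Sum.inl) a ∧
            a ∈ {a | θ.1.Realize (Sum.elim a z ∘ Sum.map id Sum.inr) ∧
              FinRank Δ Θ k m j ({x | Q (Sum.elim x (Sum.elim a z) ∘
                  Sum.map id (Sum.inr ∘ Sum.inl)) ∧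
                δ.1.Realize (Sum.elim x (Sum.elim a z) ∘ Sum.map id Sum.inl)} ∩
                {x | HasSort S x})})
        (((DefFam.kInconsistent k δ.1 _ _ θ.1.eDef).reindex Sum.inr).and
          (DefFam.exists_card (θ.1.sort ∘ Sum.inl) m _
            (fun w : Fin l ⊕ (ι ⊕ Fin r) → Imag L M => θ.1.Realize (w ∘ Sum.map id Sum.inr) ∧
              FinRank Δ Θ k m j ({x | Q (Sum.elim x w ∘ Sum.map id (Sum.inr ∘ Sum.inl)) ∧
                δ.1.Realize (Sum.elim x w ∘ Sum.map id Sum.inl)} ∩ {x | HasSort S x}))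
            ((θ.1.eDef.reindex _).and (ih _ _
              ((hQ.reindex _).and (δ.1.eDef.reindex _)))))) _
    refine key.congr fun u => ?_
    simp only [FinRank, Subtype.exists, exists_prop, Sum.elim_comp_map, Function.comp_id,
      Sum.elim_comp_inr, Sum.elim_comp_inl, ← Function.comp_assoc]
    have hset : ∀ (δ : ImFormula L M (Fin n ⊕ Fin l)) (a : Fin l → Imag L M),
        {x | Q (Sum.elim x u)} ∩ {x | HasSort S x} ∩ {x | δ.Realize (Sum.elim x a)} =
          {x | Q (Sum.elim x u) ∧ δ.Realize (Sum.elim x a)} ∩ {x | HasSort S x} := by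
      intro δ a
      ext x
      simp only [Set.mem_inter_iff, Set.mem_ofPred_eq]
      tauto
    simp only [hset]

end

section

variable {κ : Cardinal.{w}} [Nonempty M]

/-! ### Long sequences of dividing formulas -/

/-- A directed family of definable sets with unbounded finite approximations of the thorn-rank can
be cut by an instance of a formula of `Δ` whose parameter is not algebraic. -/
theorem IsMonster.exists_cut (hM : IsMonster L κ M) {n l r : ℕ}
    {Δ : Finset (ImFormula L M (Fin n ⊕ Fin l))} {Θ : Finset (ImFormula L M (Fin l ⊕ Fin r))}
    {k : ℕ} {A : Set (Imag L M)} (hA : IsSmall κ A) {ι : Type*} (U : ι → Set (Fin n → Imag L M))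
    (S : Fin n → ImSort L M) (hUS : ∀ i, ∀ x ∈ U i, HasSort S x)
    (hUA : ∀ i, ADef A fun x => x ∈ U i) (hdir : ∀ F : Finset ι, ∃ i, ∀ j ∈ F, U i ⊆ U j)
    (hU : ∀ i N, FinRank Δ Θ k (N + 1) N (U i)) :
    ∃ δ ∈ Δ, ∃ θ ∈ Θ, ∃ (a : Fin l → Imag L M) (c : Fin r → Imag L M),
      θ.Realize (Sum.elim a c) ∧ KInconsistent k δ {y | θ.Realize (Sum.elim y c)} ∧
      (∀ P, ADef (A ∪ Set.range c) P → P a → {y | P y}.Infinite) ∧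
      ∀ i N, FinRank Δ Θ k (N + 1) N (U i ∩ {x | δ.Realize (Sum.elim x a)}) := by
  classical
  -- The conditions on `(a, c)`: every set over `A ∪ Set.range c` containing `a` has at least `m`
  -- elements, for each `m` (left), and every `U i` cut by δ(x,a) keeps every finite rank (right).
  let J := ({Y : (Fin l ⊕ Fin r → Imag L M) → Prop // ADef A Y} × ℕ) ⊕ (ι × ℕ)
  let big : (Fin l → ImSort L M) → ({Y : (Fin l ⊕ Fin r → Imag L M) → Prop // ADef A Y} × ℕ) →
      (Fin r → Imag L M) → Prop := fun S' Y c =>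
    ∃ s : Finset (Fin l → Imag L M), s.card = Y.2 ∧ ∀ a ∈ s, HasSort S' a ∧
      a ∈ {a | Y.1.1 (Sum.elim a c)}
  let C : ImFormula L M (Fin n ⊕ Fin l) → ImFormula L M (Fin l ⊕ Fin r) → J →
      (Fin l ⊕ Fin r → Imag L M) → Prop := fun δ θ j z =>
    (θ.Realize z ∧ KInconsistent k δ {y | θ.Realize (Sum.elim y (z ∘ Sum.inr))}) ∧
    Sum.elim (fun Y => Y.1.1 z → big (θ.sort ∘ Sum.inl) Y (z ∘ Sum.inr))
      (fun F => FinRank Δ Θ k (F.2 + 1) F.2 (U F.1 ∩ {x | δ.Realize (Sum.elim x (z ∘ Sum.inl))})) j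
  have hC : ∀ δ θ j, ADef A (C δ θ j) := by
    rintro δ θ (Y | F)
    · exact ((θ.eDef.and ((DefFam.kInconsistent k δ _ _ θ.eDef).reindex Sum.inr)).aDef A).and
        (Y.1.2.imp (((DefFam.exists_card (θ.sort ∘ Sum.inl) Y.2).aDef Y.1.2).reindex Sum.inr))
    · refine ((θ.eDef.and ((DefFam.kInconsistent k δ _ _ θ.eDef).reindex Sum.inr)).aDef A).and
        ((((DefFam.finRank (Δ := Δ) (Θ := Θ) (k := k) S (F.2 + 1) F.2).aDef (((hUA F.1).reindex (κ := Fin n ⊕ Fin l)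
          Sum.inl).and (δ.eDef.aDef A))).reindex Sum.inl).congr fun z => ?_)
      refine iff_of_eq (congrArg (FinRank Δ Θ k (F.2 + 1) F.2) (Set.ext fun x => ?_))
      exact ⟨fun h => ⟨h, hUS _ x h.1⟩, fun h => h.1⟩
  by_contra hcon
  -- The pair `(δ, θ)` is known only after a rank has been unfolded, so failing finite sets of
  -- conditions are collected for all of the finitely many pairs beforehand.
  have hbad : ∀ q : Δ × Θ, ∃ s : Finset J, ∀ z, HasSort q.2.1.sort z → ∃ j ∈ s,
      ¬ C q.1.1 q.2.1 j z := by
    intro q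
    by_contra! hq
    obtain ⟨z, -, hz⟩ := hM.exists_realization hA q.2.1.sort (C q.1.1 q.2.1) (hC _ _) hq
    have hz' : z = Sum.elim (z ∘ Sum.inl) (z ∘ Sum.inr) := (Sum.elim_comp_inl_inr z).symm
    have hz0 := (hz (Sum.inl ⟨⟨fun _ => True, (EDef.const True).aDef A⟩, 0⟩)).1
    refine hcon ⟨q.1.1, q.1.2, q.2.1, q.2.2, z ∘ Sum.inl, z ∘ Sum.inr, hz' ▸ hz0.1, hz0.2,
      fun P hP ha => ?_, fun i N => (hz (Sum.inr (i, N))).2⟩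
    obtain ⟨Y, hY, hPY⟩ := hP.split
    rw [infinite_iff_forall_finset]
    intro m
    obtain ⟨s, hs, hs'⟩ := (hz (Sum.inl ⟨⟨Y, hY⟩, m⟩)).2 (by
      change Y z
      rw [hz']
      exact (hPY _).1 ha)
    exact ⟨s, hs, fun a ha => (hPY a).2 (hs' a ha).2⟩
  choose s hs using hbad
  let t : Finset J := Finset.univ.biUnion s
  obtain ⟨i₀, hi₀⟩ := hdir (t.toRight.image Prod.fst)
  let N := t.toRight.sup Prod.snd
  let m := ∑ Y ∈ t.toLeft, Y.2
  -- One level is spent on this unfolding, leaving rank `N + m`. It yields `N + m + 2` parameters,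
  -- more than the at most `m` that violate a counting condition.
  obtain ⟨δ, hδ, θ, hθ, c, hc, hk, s', hs', hs''⟩ := hU i₀ (N + m + 1)
  let bad : Finset (Fin l → Imag L M) := t.toLeft.biUnion fun Y =>
    if big (θ.sort ∘ Sum.inl) Y c then ∅ else s'.filter fun a => Y.1.1 (Sum.elim a c)
  have hbad : bad.card ≤ m := by
    refine Finset.card_biUnion_le.trans (Finset.sum_le_sum fun Y _ => ?_)
    split_ifs with hY
    · simp
    · by_contra! hlt
      obtain ⟨s₁, hs₁, hs₁'⟩ := Finset.exists_subset_card_eq hlt.le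
      exact hY ⟨s₁, hs₁', fun a ha => ⟨(hs'' a (Finset.mem_filter.1 (hs₁ ha)).1).1,
        (Finset.mem_filter.1 (hs₁ ha)).2⟩⟩
  obtain ⟨a, ha, hab⟩ := Finset.exists_mem_notMem_of_card_lt_card
    (show bad.card < s'.card by omega)
  obtain ⟨ha1, ha2, ha3⟩ := hs'' a ha
  obtain ⟨j, hj, hjC⟩ := hs (⟨δ, hδ⟩, ⟨θ, hθ⟩) (Sum.elim a c) ha2.hasSort
  have hjt : j ∈ t := Finset.mem_biUnion.2 ⟨_, Finset.mem_univ _, hj⟩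
  refine hjC ⟨⟨ha2, hk⟩, ?_⟩
  rcases j with Y | F
  · intro hY
    by_contra hbig
    change ¬ big (θ.sort ∘ Sum.inl) Y c at hbig
    exact hab (Finset.mem_biUnion.2 ⟨Y, Finset.mem_toLeft.2 hjt, by
      rw [if_neg hbig]
      exact Finset.mem_filter.2 ⟨ha, hY⟩⟩)
  · have hFN : F.2 ≤ N := Finset.le_sup (f := Prod.snd) (Finset.mem_toRight.2 hjt)
    exact ha3.mono (by omega) (by omega) (by omega) (Set.inter_subset_inter_left _
      (hi₀ F.1 (Finset.mem_image_of_mem _ (Finset.mem_toRight.2 hjt))))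

/-- Dependent choice along a well-order. -/
theorem exists_forall_of_wellFoundedLT {I D : Type*} [LinearOrder I] [WellFoundedLT I]
    (G : ∀ i : I, (∀ j, j < i → D) → D → Prop)
    (h : ∀ (i : I) (f : ∀ j, j < i → D),
      (∀ j hj, G j (fun k hk => f k (hk.trans hj)) (f j hj)) → ∃ d, G i f d) :
    ∃ F : I → D, ∀ i, G i (fun j _ => F j) (F i) := by
  classical
  rcases isEmpty_or_nonempty D with hD | hD
  · have : ∀ i : I, False := fun i => by
      induction i using WellFoundedLT.induction with
      | ind i ih =>
        obtain ⟨d, -⟩ := h i (fun j hj => (ih j hj).elim) fun j hj => (ih j hj).elim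
        exact isEmptyElim d
    exact ⟨fun i => (this i).elim, fun i => (this i).elim⟩
  · let F : I → D := wellFounded_lt.fix fun i f =>
      if hd : ∃ d, G i f d then hd.choose else Classical.arbitrary D
    have hF : ∀ i, F i = if hd : ∃ d, G i (fun j _ => F j) d then hd.choose else
        Classical.arbitrary D := fun i => WellFounded.fix_eq _ _ i
    refine ⟨F, fun i => ?_⟩
    induction i using WellFoundedLT.induction with
    | ind i ih =>
      have hd := h i (fun j _ => F j) ih
      rw [hF i, dif_pos hd]
      exact hd.choose_spec

/-- A set of size less than `#I`, where all proper initial segments of `I` have size at most `μ`, is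
bounded. -/
theorem exists_forall_lt_of_mk_le {I B : Type w} [LinearOrder I] {μ : Cardinal.{w}} (hμ : ℵ₀ ≤ μ)
    (hI : μ < #I) (hIic : ∀ i : I, #(Set.Iic i) ≤ μ) (hB : #B ≤ μ) (f : B → I) :
    ∃ i, ∀ b, f b < i := by
  by_contra! hcon
  have huniv : (⋃ b, Set.Iic (f b)) = Set.univ :=
    Set.eq_univ_of_forall fun i => Set.mem_iUnion.2 (hcon i)
  have h1 : #I ≤ sum fun b : B => #(Set.Iic (f b)) := by
    rw [← mk_univ, ← huniv]
    exact mk_iUnion_le_sum_mk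
  have h2 : (sum fun b : B => #(Set.Iic (f b))) ≤ #B * μ := by
    refine (sum_le_sum _ (fun _ => μ) fun b => hIic _).trans ?_
    simp
  exact absurd ((h1.trans h2).trans (mul_le_of_le hμ hB le_rfl)) (not_le.2 hI)

end

/-! ### Rosiness from local character -/

section

variable {κ : Cardinal.{w}} [Nonempty M]

/-- If the ranks `þ(φ, Δ, Θ, k)` are at least every natural number, there are long sequences of
formulas, jointly consistent with `φ`, each of which þ-divides over the previous ones. -/
theorem IsMonster.exists_dividing_sequence (hM : IsMonster L κ M) {n l r : ℕ}
    {Δ : Finset (ImFormula L M (Fin n ⊕ Fin l))} {Θ : Finset (ImFormula L M (Fin l ⊕ Fin r))}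
    {k : ℕ} {φ : ParamFormula L M n}
    (hφ : ∀ j : ℕ, ThornRankGE Δ Θ k (j : Ordinal.{max u v w}) {x | φ.Realize x})
    {I : Type (max u v w)} [LinearOrder I] [WellFoundedLT I]
    (hI : ∀ A : I → Set (Imag L M), (∀ i, (A i).Finite) → IsSmall κ (⋃ i, A i)) :
    ∃ (δ : I → ImFormula L M (Fin n ⊕ Fin l)) (θ : I → ImFormula L M (Fin l ⊕ Fin r))
      (a : I → Fin l → Imag L M) (c : I → Fin r → Imag L M),
      (∀ i, (θ i).Realize (Sum.elim (a i) (c i)) ∧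
        KInconsistent k (δ i) {y | (θ i).Realize (Sum.elim y (c i))} ∧
        ∀ P, ADef ((⋃ j : {j // j < i}, (Set.range (a j) ∪ Set.range (c j))) ∪
          Set.range (c i)) P → P (a i) → {y | P y}.Infinite) ∧
      ∀ F : Finset I, ∃ x, φ.Realize x ∧ ∀ j ∈ F, (δ j).Realize (Sum.elim x (a j)) := by
  classical
  let D := ImFormula L M (Fin n ⊕ Fin l) × ImFormula L M (Fin l ⊕ Fin r) ×
    (Fin l → Imag L M) × (Fin r → Imag L M)
  let par : D → Set (Imag L M) := fun d => Set.range d.2.2.1 ∪ Set.range d.2.2.2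
  have hpar : ∀ d, (par d).Finite := fun d => (Set.finite_range _).union (Set.finite_range _)
  let V : D → Set (Fin n → Imag L M) := fun d => {x | d.1.Realize (Sum.elim x d.2.2.1)}
  -- Only finite sets of earlier indices enter, so the construction treats limit stages and
  -- successor stages alike.
  let U : ∀ F : Finset I, (∀ j ∈ F, D) → Set (Fin n → Imag L M) := fun F f =>
    {x | φ.Realize x ∧ ∀ j (hj : j ∈ F), x ∈ V (f j hj)}
  let G : ∀ i : I, (∀ j, j < i → D) → D → Prop := fun i f d =>
    d.2.1.Realize (Sum.elim d.2.2.1 d.2.2.2) ∧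
    KInconsistent k d.1 {y | d.2.1.Realize (Sum.elim y d.2.2.2)} ∧
    (∀ P, ADef ((⋃ j : {j // j < i}, par (f j j.2)) ∪ Set.range d.2.2.2) P → P d.2.2.1 →
      {y | P y}.Infinite) ∧
    ∀ (F : Finset I) (hF : ∀ j ∈ F, j < i) (N : ℕ),
      FinRank Δ Θ k (N + 1) N (U F (fun j hj => f j (hF j hj)) ∩ V d)
  -- The largest index of `F` suffices: the condition imposed at its stage already bounds the rank
  -- of its intersection with the rest of `F`.
  have hU : ∀ (F : Finset I) (f : ∀ j ∈ F, D), (∀ (j : I) (hj : j ∈ F) (N : ℕ),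
      (∀ i ∈ F, i ≤ j) → FinRank Δ Θ k (N + 1) N
        (U (F.erase j) (fun i hi => f i (Finset.mem_of_mem_erase hi)) ∩ V (f j hj))) →
      ∀ N, FinRank Δ Θ k (N + 1) N (U F f) := by
    intro F f h N
    rcases F.eq_empty_or_nonempty with rfl | hF
    · exact ((hφ N).finRank (Nat.succ_pos N)).mono le_rfl (Nat.succ_pos N) le_rfl
        fun x hx => ⟨hx, fun j hj => absurd hj (Finset.notMem_empty j)⟩
    · refine (h _ (F.max'_mem hF) N fun i hi => F.le_max' i hi).mono le_rfl (Nat.succ_pos N) le_rfl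
        fun x hx => ⟨hx.1.1, fun j hj => ?_⟩
      by_cases hjm : j = F.max' hF
      · subst hjm
        exact hx.2
      · exact hx.1.2 j (Finset.mem_erase.2 ⟨hjm, hj⟩)
  obtain ⟨f, hf⟩ := exists_forall_of_wellFoundedLT G (by
    intro i f hf
    let β := {F : Finset I // ∀ j ∈ F, j < i}
    let A : Set (Imag L M) := ⋃ j : {j // j < i}, par (f j j.2)
    let B : Set (Imag L M) := Set.range φ.params ∪ A
    have hA : IsSmall κ A := (hI (fun j => if hj : j < i then par (f j hj) else ∅) (by
        intro j
        split_ifs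
        · exact hpar _
        · exact Set.finite_empty)).mono (by
      refine Set.iUnion_subset fun j => ?_
      refine Set.Subset.trans ?_ (Set.subset_iUnion _ j.1)
      rw [dif_pos j.2])
    have hB : IsSmall κ B := hM.isSmall_union (hM.isSmall_of_finite (Set.finite_range _)) hA
    obtain ⟨δ, hδ, θ, hθ, a, c, h1, h2, h3, h4⟩ := hM.exists_cut (Δ := Δ) (Θ := Θ) (k := k) hB
      (fun F : β => U F.1 fun j hj => f j (F.2 j hj)) (φ.formula.sort ∘ Sum.inl)
      (fun F x hx => ImFormula.Realize.hasSort_inl hx.1)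
      (fun F => by
        refine ((ParamFormula.aDef (A := B) fun i => Or.inl ⟨i, rfl⟩).and
          (ADef.all fun j : F.1 => ((f j (F.2 j j.2)).1.eDef.aDef B).subst
            (d := (f j (F.2 j j.2)).2.2.1) fun t => Or.inr (Set.mem_iUnion.2
              ⟨⟨j, F.2 j j.2⟩, Or.inl ⟨t, rfl⟩⟩))).congr fun x => ?_
        exact ⟨fun h => ⟨h.1, fun j => h.2 j.1 j.2⟩, fun h => ⟨h.1, fun j hj => h.2 ⟨j, hj⟩⟩⟩)
      (fun Fs => ⟨⟨Fs.biUnion Subtype.val, fun j hj => by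
          obtain ⟨F, -, hF⟩ := Finset.mem_biUnion.1 hj
          exact F.2 j hF⟩, fun F hF x hx =>
            ⟨hx.1, fun j hj => hx.2 j (Finset.mem_biUnion.2 ⟨F, hF, hj⟩)⟩⟩)
      (fun F => hU F.1 _ fun j hj N hmax => (hf j (F.2 j hj)).2.2.2 (F.1.erase j) (fun i hi =>
        lt_of_le_of_ne (hmax i (Finset.mem_of_mem_erase hi)) (Finset.ne_of_mem_erase hi)) N)
    exact ⟨⟨δ, θ, a, c⟩, h1, h2, fun P hP => h3 P (hP.mono
      (Set.union_subset_union_left _ Set.subset_union_right)), fun F hF N => h4 ⟨F, hF⟩ N⟩)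
  refine ⟨fun i => (f i).1, fun i => (f i).2.1, fun i => (f i).2.2.1, fun i => (f i).2.2.2,
    fun i => ⟨(hf i).1, (hf i).2.1, (hf i).2.2.1⟩, fun F => ?_⟩
  obtain ⟨x, hx⟩ := (hU F (fun j _ => f j) (fun j hj N hmax => (hf j).2.2.2 (F.erase j)
    (fun i hi => lt_of_le_of_ne (hmax i (Finset.mem_of_mem_erase hi))
      (Finset.ne_of_mem_erase hi)) N) 0).nonempty Nat.one_pos
  exact ⟨x, hx.1, hx.2⟩

/-- If all types over small sets satisfy local character, the theory is rosy. -/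
theorem IsMonster.isRosy_of_localCharacter (hM : IsMonster L κ M)
    (hloc : ∀ (n : ℕ) (b : Fin n → Imag L M) (B : Set (Imag L M)), IsSmall κ B →
      (tp b B).LocalCharacter) : IsRosy L M := by
  classical
  intro n l r φ Δ Θ k
  by_contra! hφ
  let μ : Cardinal.{max u v w} := Cardinal.lift.{w} (theoryCard L)
  have hμ : ℵ₀ ≤ μ := aleph0_le_lift.2 (le_max_left _ _)
  -- The length |T|⁺ is long enough that a subset of size at most |T| is bounded, and short enough
  -- for all parameters together to be small, as |T|⁺ < `κ`.
  let I : Type (max u v w) := (Order.succ μ).ord.ToType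
  have hIc : #I = Order.succ μ := by simp [I]
  have hIic : ∀ i : I, #(Set.Iic i) ≤ μ := by
    intro i
    have h1 : #(Set.Iio i) ≤ μ := by
      refine Order.lt_succ_iff.1 ?_
      exact (mk_Iio_lt i (by simp [I])).trans_eq hIc
    rw [← Set.Iio_insert]
    exact mk_insert_le.trans (add_le_of_le hμ h1 (one_le_aleph0.trans hμ))
  have hsmall : ∀ A : I → Set (Imag L M), (∀ i, (A i).Finite) → IsSmall κ (⋃ i, A i) := by
    intro A hA
    refine hM.isSmall_of_le ?_
    refine mk_iUnion_le_sum_mk.trans ((sum_le_sum _ (fun _ => ℵ₀) fun i =>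
      (hA i).lt_aleph0.le).trans ?_)
    have hμ' : ℵ₀ ≤ Order.succ μ := hμ.trans (Order.le_succ μ)
    simp only [sum_const, lift_id, hIc]
    exact mul_le_of_le hμ' le_rfl hμ'
  obtain ⟨δ, θ, a, c, hseq, hcons⟩ := hM.exists_dividing_sequence (fun j => hφ j) hsmall
  let B : Set (Imag L M) := ⋃ i, (Set.range (a i) ∪ Set.range (c i))
  have hB : IsSmall κ B := hsmall _ fun i => (Set.finite_range _).union (Set.finite_range _)
  have haB : ∀ i t, a i t ∈ B := fun i t => Set.mem_iUnion.2 ⟨i, Or.inl ⟨t, rfl⟩⟩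
  obtain ⟨b, -, hb⟩ := hM.exists_realization hB (φ.formula.sort ∘ Sum.inl)
    (fun i x => (δ i).Realize (Sum.elim x (a i)))
    (fun i => ((δ i).eDef.aDef B).subst (haB i)) (by
      intro F
      obtain ⟨x, hx, hx'⟩ := hcons F
      exact ⟨x, ImFormula.Realize.hasSort_inl hx, hx'⟩)
  obtain ⟨B₀, hB₀, hB₀c, hfork⟩ := hloc n b B hB
  have hidx : ∀ e : B₀, ∃ i, e.1 ∈ Set.range (a i) ∪ Set.range (c i) :=
    fun e => Set.mem_iUnion.1 (hB₀ e.2)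
  choose idx hidx using hidx
  obtain ⟨i, hi⟩ := exists_forall_lt_of_mk_le hμ (by rw [hIc]; exact Order.lt_succ μ) hIic hB₀c idx
  have hsub : B₀ ⊆ ⋃ j : {j // j < i}, (Set.range (a j) ∪ Set.range (c j)) :=
    fun e he => Set.mem_iUnion.2 ⟨⟨idx ⟨e, he⟩, hi _⟩, hidx ⟨e, he⟩⟩
  obtain ⟨h1, h2, h3⟩ := hseq i
  -- The formula δ_i(x,a_i) lies in tp(b/B) and þ-divides over `B₀` by means of `c i`, the witness
  -- being the set defined by θ_i(y,c_i).
  refine hfork ⟨⟨l, δ i, a i⟩, ⟨haB i, hb i⟩, 1, fun _ => ⟨l, δ i, a i⟩,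
    fun _ => ⟨r, c i, ?_⟩, fun x hx => ⟨0, hx⟩⟩
  rw [hM.stronglyDivides_iff (hM.isSmall_union_range (hB.mono hB₀) _)]
  exact ⟨fun X hX => h3 X (hX.mono (Set.union_subset_union_left _ hsub)), k,
    fun y => (θ i).Realize (Sum.elim y (c i)),
    ((θ i).eDef.aDef _).subst fun t => Or.inr ⟨t, rfl⟩, h1, h2⟩

end

end Thorn

theorem mainTheorem3 {L : FirstOrder.Language.{u, v}} (T : L.Theory) (hT : T.IsComplete)
    (κ : Cardinal.{w}) (M : Type w) [L.Structure M] [Nonempty M] [M ⊨ T]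
    (hM : Thorn.IsMonster L κ M) (P : ∀ n : ℕ, Set (Thorn.CompleteType L M n))
    (hP : Thorn.FinitelyCoordinatized P) (hrosy : ∀ n : ℕ, ∀ p ∈ P n, p.IsRosy κ) :
    Thorn.IsRosy L M :=
  hM.isRosy_of_localCharacter fun _ b _ hB => hM.localCharacter hP hrosy b hB
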